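/- **Conventions.** A gate is an arbitrary unitary on one or two qubits. An $(\alpha,a,\varepsilon)$-block-encoding of an operator $A$ on $s$ qubits is a unitary $U$ on $a+s$ qubits with $\|A-\alpha(\langle 0^a|\otimes I)U(|0^a\rangle\otimes I)\|_2\le\varepsilon$. Let $H$ be a Hermitian operator on $s$ qubits, and let $U_H$ be an $(\alpha_{H},a,0)$-block-encoding of $H$ that is given by a circuit of $G_{H}$ gates. (For a chain of coupled oscillators, $H$ is its Hamiltonian.) A simulation circuit acts on the $a+s$ qubits of $U_H$ and on $b$ further ancillas. It consists of gates and of controlled uses of $U_H$ or $U_H^\dagger$. Each such use is charged $G_{H}$; every other gate is charged $1$. For $\alpha_{H}\ge 0$, $\alpha_{\mathrm{HS}}\ge 2$, $0<\varepsilon<1$, $t\ge 0$ and a nonzero initial vector $\psi_0$ put $$G_{\mathrm{HS+AA}}(t)=\Bigl(2\Bigl\lceil \tfrac{|\alpha_{\mathrm{HS}}|}{\|\psi_0\|_2}\Bigr\rceil+1\Bigr)\Bigl(2\bigl\lceil 2.8\,\alpha_{H}t+\ln(1/\varepsilon)\bigr\rceil-1\Bigr)G_{H}.$$ **Statement.**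 There is an absolute constant $C$ such that the following holds. Let $t_i\ge 0$, $\Delta t>0$, and let $M=(t_f-t_i)/\Delta t$ be a nonnegative integer; put $t_j=t_i+j\Delta t$. There are simulation circuits $V_j$ and $S_j$, $j=0,\dots,M$, with a common number $b$ of further ancillas, that depend only on $s,a,\alpha_{H},\alpha_{\mathrm{HS}},\varepsilon,\|\psi_0\|_2,t_i,\Delta t,M$ (not on $H$, $U_H$ or the direction of $\psi_0$), such that for all $H$, $U_H$, $\psi_0$ as above and all $j$: 1. $V_j$ is an $(\alpha_{\mathrm{HS}},a+b,\varepsilon)$-block-encoding of $e^{-iHt_j}$ with exactly $2\lceil 2.8\,\alpha_{H}t_j+\ln(1/\varepsilon)\rceil-1$ uses of $U_H^{\pm1}$. 2. $S_j$ is an $\varepsilon$-close simulation at time $t_j$: when it is run on $|0^{a+b}\rangle\otimes\psi_0/\|\psi_0\|$, all ancillas are measured to be $0$ with probability at least $1-\varepsilon$, and the normalized state of the signal qubits is then within $\varepsilon$, in norm, of $e^{-iHt_j}\psi_0/\|\psi_0\|$. It has exactly $2\lceil|\alpha_{\mathrm{HS}}|/\|\psi_0\|\rceil+1$ times as many uses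 of $U_H^{\pm1}$ as $V_j$. 3. $V_j$ and $S_j$ have at most $C(a+1)$ other gates per use of $U_H^{\pm1}$. Consequently the total cost of the uses of the block-encoding in the whole simulation $S_0,\dots,S_M$ is exactly $$G_{\mathrm{sim}}=\sum_{j=0}^{M}G_{\mathrm{HS+AA}}(t_i+j\Delta t),$$ and the total number of gates, with all other gates counted, is at most $G_{\mathrm{sim}}+C(a+1)\,G_{\mathrm{sim}}/G_{H}$, where $G_{\mathrm{sim}}/G_{H}$ denotes the same sum with $G_{H}$ replaced by $1$. -/

import Mathlib

open scoped Matrix Matrix.Norms.L2Operator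

noncomputable section

namespace OscSim

/-! Computational basis states of a register whose qubits are indexed by `ι` are the functions
`ι → Bool` (`false` is `|0⟩`, `true` is `|1⟩`); operators on the register are matrices indexed by
them. `‖A‖` is the spectral norm of a matrix. -/

/-- Operators on the register with set of qubits `ι`. -/
abbrev QOp (ι : Type) : Type := Matrix (ι → Bool) (ι → Bool) ℂ

/-- State vectors of the register with set of qubits `ι`, with the Euclidean norm. -/
abbrev QVec (ι : Type) [Fintype ι] [DecidableEq ι] : Type := EuclideanSpace ℂ (ι → Bool)

/-- An elementary gate: an arbitrary unitary on one qubit or on two distinct qubits. -/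
inductive Gate (ι : Type) : Type
  | one (q : ι) (u : Matrix.unitaryGroup Bool ℂ) : Gate ι
  | two (p q : ι) (hpq : p ≠ q) (u : Matrix.unitaryGroup (Bool × Bool) ℂ) : Gate ι

/-- The operator on the whole register: the gate on its qubits, the identity on all others. -/
def Gate.toOp {ι : Type} [Fintype ι] [DecidableEq ι] : Gate ι → QOp ι
  | .one q u => fun x y => if ∀ i, i ≠ q → x i = y i then u.1 (x q) (y q) else 0
  | .two p q _ u => fun x y =>
      if ∀ i, i ≠ p → i ≠ q → x i = y i then u.1 (x p, x q) (y p, y q) else 0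

/-- The operator of a gate list; the head of the list is applied first. -/
def circuitOp {ι : Type} [Fintype ι] [DecidableEq ι] : List (Gate ι) → QOp ι
  | [] => 1
  | g :: c => circuitOp c * g.toOp

/-- `(⟨0| ⊗ I) U (|0⟩ ⊗ I)`, for ancilla qubits `κ` and signal qubits `σ`. -/
def zeroBlock {κ σ : Type} (U : QOp (κ ⊕ σ)) : QOp σ :=
  fun x y => U (Sum.elim (fun _ => false) x) (Sum.elim (fun _ => false) y)

/-- `U` is an `(α, |κ|, ε)`-block-encoding of `A`. -/
structure IsBlockEncoding {κ σ : Type} [Fintype κ] [DecidableEq κ] [Fintype σ] [DecidableEq σ]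
    (α ε : ℝ) (A : QOp σ) (U : QOp (κ ⊕ σ)) : Prop where
  alpha_nonneg : 0 ≤ α
  eps_nonneg : 0 ≤ ε
  unitary : U ∈ Matrix.unitaryGroup (κ ⊕ σ → Bool) ℂ
  error_le : ‖A - (α : ℂ) • zeroBlock U‖ ≤ ε

/-- The qubits of a simulation circuit: `b` further ancillas, the `a` ancillas of the
block-encoding of the Hamiltonian, and the `s` signal qubits. -/
abbrev Wires (b a s : ℕ) : Type := (Fin b ⊕ Fin a) ⊕ Fin s

/-- The part of a basis state that lies in the register of the block-encoding. -/
def bePart {b a s : ℕ} (x : Wires b a s → Bool) : Fin a ⊕ Fin s → Bool :=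
  Sum.elim (fun i => x (Sum.inl (Sum.inr i))) (fun i => x (Sum.inr i))

/-- One step of a simulation circuit: an elementary gate, or one use of the block-encoding `U` of
the Hamiltonian (or of its adjoint, if `adj`), controlled by one of the further ancillas. -/
inductive Step (b a s : ℕ) : Type
  | gate (g : Gate (Wires b a s)) : Step b a s
  | call (c : Fin b) (adj : Bool) : Step b a s

/-- The operator of a step, when the block-encoding is `U`. -/
def Step.toOp {b a s : ℕ} (U : QOp (Fin a ⊕ Fin s)) : Step b a s → QOp (Wires b a s)
  | .gate g => g.toOp
  | .call c adj => fun x y =>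
      if ∀ i : Fin b, x (Sum.inl (Sum.inl i)) = y (Sum.inl (Sum.inl i)) then
        if y (Sum.inl (Sum.inl c)) = true then
          (if adj = true then Uᴴ else U) (bePart x) (bePart y)
        else (1 : QOp (Fin a ⊕ Fin s)) (bePart x) (bePart y)
      else 0

/-- A simulation circuit. It does not depend on the block-encoding that it calls. -/
abbrev Program (b a s : ℕ) : Type := List (Step b a s)

/-- The operator of a simulation circuit; the head of the list is applied first. -/
def Program.toOp {b a s : ℕ} (U : QOp (Fin a ⊕ Fin s)) : Program b a s → QOp (Wires b a s)
  | [] => 1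
  | st :: P => Program.toOp U P * st.toOp U

/-- The number of uses of the block-encoding (or of its adjoint). -/
def Program.calls {b a s : ℕ} : Program b a s → ℕ
  | [] => 0
  | .gate _ :: P => Program.calls P
  | .call _ _ :: P => Program.calls P + 1

/-- The number of elementary gates outside of the uses of the block-encoding. -/
def Program.otherGates {b a s : ℕ} : Program b a s → ℕ
  | [] => 0
  | .gate _ :: P => Program.otherGates P + 1
  | .call _ _ :: P => Program.otherGates P

/-- The gate complexity of a simulation circuit: a use of the block-encoding costs the number `G`
of gates of the block-encoding circuit, every other gate costs `1`. -/
def Program.gateComplexity {b a s : ℕ} (G : ℕ) (P : Program b a s) : ℕ :=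
  G * Program.calls P + Program.otherGates P

/-- The operator `exp (-i H t)`. -/
def evolution {s : ℕ} (H : QOp (Fin s)) (t : ℝ) : QOp (Fin s) :=
  NormedSpace.exp ((-(Complex.I * (t : ℂ))) • H)

/-- `(⟨0| ⊗ I) W (|0⟩ ⊗ ψ)`: the unnormalized state of the signal qubits when the circuit `W` is run
on `|0⟩ ⊗ ψ` and all ancillas are then measured to be `0`. Its squared norm is the probability of
that outcome if `ψ` is a unit vector. -/
def postselect {κ σ : Type} [Fintype σ] [DecidableEq σ] (W : QOp (κ ⊕ σ)) (ψ : QVec σ) : QVec σ :=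
  Matrix.toEuclideanLin (zeroBlock W) ψ

/-- Number of uses of the block-encoding of `H` in one block-encoding of `exp (-i H t)`. -/
def evolutionCalls (αH ε t : ℝ) : ℤ :=
  2 * ⌈2.8 * αH * t + Real.log (1 / ε)⌉ - 1

/-- Number of uses of the block-encoding of `exp (-i H t)` in amplitude amplification, for an initial
state of norm `ν`. -/
def amplificationCalls (αHS ν : ℝ) : ℤ :=
  2 * ⌈|αHS| / ν⌉ + 1

/-- `G_{HS+AA}` at the simulation time `t`, for a block-encoding of `H` with `G` gates. -/
def costHSAA (αH αHS ε ν : ℝ) (G : ℕ) (t : ℝ) : ℤ :=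
  amplificationCalls αHS ν * evolutionCalls αH ε t * (G : ℤ)

/-- `G_sim`: the sum of `G_{HS+AA}` over the times `ti + j Δt`, `j = 0, …, M`. -/
def costSim (αH αHS ε ν : ℝ) (G : ℕ) (ti Δt : ℝ) (M : ℕ) : ℤ :=
  ∑ j ∈ Finset.range (M + 1), costHSAA αH αHS ε ν G (ti + j * Δt)

end OscSim

end

/-!
The Taylor series of `exp (-i H t)`, truncated after `2 n` terms, splits into an even and an odd
part. For `x = (z + 1 / z) / 2` each part is, up to a power of `z`, a polynomial in `z ^ 2`, which
Fejér–Riesz completes to a unit pair on the circle; peeling off leading coefficients writes the pair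
as a product of one-qubit gates interleaved with `diag (1, X)`, that is, as quantum signal
processing of the block-encoding of `H`. A linear combination of the two parts block-encodes a
multiple of the truncated series. The reflections about zero ancillas are ladders of `O (a)` gates.

A rotation of one ancilla turns the multiple into the prescribed `1 / αHS`. For the simulation the
multiple is `1 / 2`, where one round of oblivious amplitude amplification already produces the
evolution without magnifying the truncation error to first order; the remaining prescribed uses of
the block-encoding are controlled by a qubit that is always `0`.
-/

noncomputable section

namespace OscSim

section UnitCircle

open Polynomial ComplexConjugate

instance instInfiniteCircle : Infinite Circle := by
  have : Infinite (Set.Ioc (-Real.pi) Real.pi) :=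
    (Set.Ioc_infinite (neg_lt_self Real.pi_pos)).to_subtype
  refine Infinite.of_injective (fun x : Set.Ioc (-Real.pi) Real.pi => Circle.exp x) fun x y h => ?_
  have harg := congrArg (fun w : Circle => (w : ℂ).arg) h
  simp only [Circle.arg_exp x.2.1 x.2.2, Circle.arg_exp y.2.1 y.2.2] at harg
  exact Subtype.ext harg

theorem eq_of_eval_circle {p q : ℂ[X]} (h : ∀ w : Circle, p.eval (w : ℂ) = q.eval (w : ℂ)) :
    p = q :=
  eq_of_infinite_eval_eq p q
    ((Set.infinite_range_of_injective (α := Circle) Circle.coe_injective).mono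
      (Set.range_subset_iff.2 h))

theorem circle_mul_conj (w : Circle) : (w : ℂ) * conj (w : ℂ) = 1 := by
  rw [Complex.mul_conj, Circle.normSq_coe, Complex.ofReal_one]

/-- The reflection `X ^ N * conj p (1 / X)` of a polynomial `p` of degree at most `N`: on the unit
circle its value is `w ^ N` times the conjugate of `p w`. -/
def conjReflect (N : ℕ) (p : ℂ[X]) : ℂ[X] := reflect N (p.map (starRingEnd ℂ))

variable {N d : ℕ} {p G : ℂ[X]}

theorem natDegree_conjReflect_le (hp : p.natDegree ≤ N) : (conjReflect N p).natDegree ≤ N :=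
  natDegree_reflect_le.trans (max_le le_rfl (natDegree_map_le.trans hp))

theorem coeff_self_conjReflect : (conjReflect N p).coeff N = conj (p.coeff 0) := by
  rw [conjReflect, coeff_reflect, revAt_le le_rfl, Nat.sub_self, coeff_map]

theorem eval_conjReflect (hp : p.natDegree ≤ N) {z : ℂ} (hz : z ≠ 0) :
    (conjReflect N p).eval z = z ^ N * conj (p.eval (conj z)⁻¹) := by
  let _ : Invertible z⁻¹ := invertibleOfNonzero (inv_ne_zero hz)
  have hreflect := eval₂_reflect_mul_pow (RingHom.id ℂ) z⁻¹ N (p.map (starRingEnd ℂ))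
    (natDegree_map_le.trans hp)
  have hmap : (p.map (starRingEnd ℂ)).eval z⁻¹ = conj (p.eval (conj z)⁻¹) := by
    conv_lhs => rw [← Complex.conj_conj z⁻¹, map_inv₀]
    exact eval_map_apply _ _
  rw [invOf_eq_inv, inv_inv, ← eval, ← eval, inv_pow, hmap] at hreflect
  rw [conjReflect, ← hreflect, mul_comm, mul_assoc, inv_mul_cancel₀ (pow_ne_zero N hz), mul_one]

theorem eval_circle_conjReflect (hp : p.natDegree ≤ N) (w : Circle) :
    (conjReflect N p).eval (w : ℂ) = w ^ N * conj (p.eval (w : ℂ)) := by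
  rw [eval_conjReflect hp w.coe_ne_zero, ← Circle.coe_inv_eq_conj, Circle.coe_inv, inv_inv]

theorem eval_circle_mul_conjReflect (hp : p.natDegree ≤ N) (w : Circle) :
    (p * conjReflect N p).eval (w : ℂ) = w ^ N * (‖p.eval (w : ℂ)‖ : ℂ) ^ 2 := by
  rw [eval_mul, eval_circle_conjReflect hp, mul_left_comm, Complex.mul_conj']

/-- The trigonometric polynomial `w ^ (-d) * G w` takes positive values on the unit circle. -/
def PosOnCircle (d : ℕ) (G : ℂ[X]) : Prop :=
  ∀ w : Circle, ∃ ρ : ℝ, 0 < ρ ∧ G.eval (w : ℂ) = w ^ d * ρ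

theorem PosOnCircle.conjReflect_eq (hG : PosOnCircle d G) (hdeg : G.natDegree ≤ 2 * d) :
    conjReflect (2 * d) G = G := by
  refine eq_of_eval_circle fun w => ?_
  obtain ⟨ρ, -, hρ⟩ := hG w
  rw [eval_circle_conjReflect hdeg, hρ, map_mul, map_pow, Complex.conj_ofReal, two_mul, pow_add,
    ← mul_assoc, mul_assoc ((w : ℂ) ^ d), ← mul_pow, circle_mul_conj, one_pow, mul_one]

theorem PosOnCircle.eval_ne_zero (hG : PosOnCircle d G) (w : Circle) : G.eval (w : ℂ) ≠ 0 := by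
  obtain ⟨ρ, hpos, hρ⟩ := hG w
  rw [hρ]
  exact mul_ne_zero (pow_ne_zero _ w.coe_ne_zero) (Complex.ofReal_ne_zero.2 hpos.ne')

theorem PosOnCircle.isRoot_inv_conj (hG : PosOnCircle d G) (hdeg : G.natDegree ≤ 2 * d) {z : ℂ}
    (hz0 : z ≠ 0) (hz : G.IsRoot z) : G.IsRoot (conj z)⁻¹ := by
  have hy : (conj z)⁻¹ ≠ 0 := inv_ne_zero ((_root_.map_ne_zero _).2 hz0)
  have h := eval_conjReflect hdeg hy
  rwa [hG.conjReflect_eq hdeg, map_inv₀, Complex.conj_conj, inv_inv, hz.eq_zero, map_zero,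
    mul_zero] at h

theorem PosOnCircle.exists_mul_quadratic (hG : PosOnCircle d G) (hdeg : G.natDegree ≤ 2 * d)
    {z : ℂ} (hz0 : z ≠ 0) (hz : G.IsRoot z) :
    ∃ G' : ℂ[X], G = (X - C z) * ((X - C (conj z)⁻¹) * G') := by
  have hne : (conj z)⁻¹ ≠ z := fun h => by
    have hnorm : ‖z‖ = 1 := by
      have hmul : z * conj z = 1 := by
        nth_rw 1 [← h]
        exact inv_mul_cancel₀ ((_root_.map_ne_zero _).2 hz0)
      rw [Complex.mul_conj'] at hmul
      exact (pow_eq_one_iff_of_nonneg (norm_nonneg z) two_ne_zero).1 (by exact_mod_cast hmul)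
    exact hG.eval_ne_zero ⟨z, mem_sphere_zero_iff_norm.2 hnorm⟩ hz.eq_zero
  obtain ⟨G₁, rfl⟩ := dvd_iff_isRoot.2 hz
  have hroot := (hG.isRoot_inv_conj hdeg hz0 hz).eq_zero
  rw [eval_mul, eval_sub, eval_X, eval_C] at hroot
  obtain ⟨G', rfl⟩ := dvd_iff_isRoot.2 ((mul_eq_zero.1 hroot).resolve_left (sub_ne_zero.2 hne))
  exact ⟨G', rfl⟩

theorem circle_sub_mul_sub_inv_conj (w : Circle) {z : ℂ} (hz : z ≠ 0) :
    ((w : ℂ) - z) * (w - (conj z)⁻¹) = w * (‖(w : ℂ) - z‖ : ℂ) ^ 2 * -(conj z)⁻¹ := by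
  have hcz : (conj z)⁻¹ * conj z = 1 := inv_mul_cancel₀ ((_root_.map_ne_zero _).2 hz)
  rw [← Complex.mul_conj', map_sub]
  linear_combination (w - z) * ((conj z)⁻¹ * circle_mul_conj w) - ((w : ℂ) - z) * w * hcz

/-- Roots off the unit circle come in pairs `z`, `1 / conj z`; a root at `0` is paired with the
missing leading coefficient. -/
theorem PosOnCircle.exists_eval_eq_mul_norm_sq (hG : PosOnCircle (d + 1) G)
    (hdeg : G.natDegree ≤ 2 * (d + 1)) :
    ∃ (z : ℂ) (G' : ℂ[X]), G'.natDegree ≤ 2 * d ∧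
      ∀ w : Circle, G.eval (w : ℂ) = w * (‖(w : ℂ) - z‖ : ℂ) ^ 2 * G'.eval (w : ℂ) := by
  have hlead : G.coeff (2 * (d + 1)) = conj (G.coeff 0) := by
    rw [← coeff_self_conjReflect, hG.conjReflect_eq hdeg]
  by_cases h0 : G.coeff 0 = 0
  · refine ⟨0, G.divX, ?_, fun w => ?_⟩
    · have := natDegree_le_pred hdeg (by rw [hlead, h0, map_zero])
      rw [natDegree_divX_eq_natDegree_tsub_one]
      omega
    · conv_lhs => rw [← divX_mul_X_add G, h0, C_0, add_zero]
      rw [eval_mul, eval_X, sub_zero, Circle.norm_coe, Complex.ofReal_one, one_pow, mul_one,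
        mul_comm]
  · have hpos : 0 < G.natDegree :=
      (Nat.mul_pos two_pos d.succ_pos).trans_le
        (le_natDegree_of_ne_zero (hlead ▸ (_root_.map_ne_zero _).2 h0))
    obtain ⟨z, hz⟩ := Complex.exists_root (natDegree_pos_iff_degree_pos.1 hpos)
    have hz0 : z ≠ 0 := by
      rintro rfl
      exact h0 ((coeff_zero_eq_eval_zero G).trans hz)
    obtain ⟨G', rfl⟩ := hG.exists_mul_quadratic hdeg hz0 hz
    refine ⟨z, C (-(conj z)⁻¹) * G', ?_, fun w => ?_⟩
    · have hG' : G' ≠ 0 := by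
        rintro rfl
        simp at h0
      rw [natDegree_mul (X_sub_C_ne_zero _) (mul_ne_zero (X_sub_C_ne_zero _) hG'),
        natDegree_mul (X_sub_C_ne_zero _) hG', natDegree_X_sub_C, natDegree_X_sub_C] at hdeg
      exact (natDegree_C_mul_le _ _).trans (by omega)
    · simp only [eval_mul, eval_sub, eval_X, eval_C]
      rw [← mul_assoc, circle_sub_mul_sub_inv_conj w hz0, mul_assoc]

theorem PosOnCircle.of_mul_norm_sq (hG : PosOnCircle (d + 1) G) {z : ℂ} {G' : ℂ[X]}
    (h : ∀ w : Circle, G.eval (w : ℂ) = w * (‖(w : ℂ) - z‖ : ℂ) ^ 2 * G'.eval (w : ℂ)) :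
    PosOnCircle d G' := by
  intro w
  obtain ⟨ρ, hpos, hρ⟩ := hG w
  have hwz : (‖(w : ℂ) - z‖ : ℂ) ≠ 0 := fun h0 => hG.eval_ne_zero w (by simp [h, h0])
  refine ⟨ρ / ‖(w : ℂ) - z‖ ^ 2, div_pos hpos (sq_pos_of_ne_zero (by exact_mod_cast hwz)),
    mul_left_cancel₀ (mul_ne_zero w.coe_ne_zero (pow_ne_zero 2 hwz)) ?_⟩
  rw [← h, hρ]
  push_cast
  field_simp
  ring

/-- The Fejér–Riesz theorem, for strictly positive trigonometric polynomials. -/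
theorem PosOnCircle.exists_norm_sq_eq (hG : PosOnCircle d G) (hdeg : G.natDegree ≤ 2 * d) :
    ∃ q : ℂ[X], q.natDegree ≤ d ∧
      ∀ w : Circle, G.eval (w : ℂ) = w ^ d * (‖q.eval (w : ℂ)‖ : ℂ) ^ 2 := by
  induction d generalizing G with
  | zero =>
    obtain ⟨ρ, hpos, hρ⟩ := hG 1
    have hconst : ∀ w : ℂ, G.eval w = ρ := by
      rw [eq_C_of_natDegree_le_zero hdeg] at hρ ⊢
      simpa using hρ
    refine ⟨C (√ρ : ℂ), (natDegree_C _).le, fun w => ?_⟩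
    rw [hconst, eval_C, Complex.norm_real, Real.norm_of_nonneg (Real.sqrt_nonneg ρ), pow_zero,
      one_mul, ← Complex.ofReal_pow, Real.sq_sqrt hpos.le]
  | succ d ih =>
    obtain ⟨z, G', hdeg', hGG'⟩ := hG.exists_eval_eq_mul_norm_sq hdeg
    obtain ⟨q, hq, hqG'⟩ := ih (hG.of_mul_norm_sq hGG') hdeg'
    refine ⟨(X - C z) * q, ?_, fun w => ?_⟩
    · refine natDegree_mul_le.trans ?_
      rw [natDegree_X_sub_C, add_comm]
      exact Nat.succ_le_succ hq
    · rw [hGG', hqG', eval_mul, eval_sub, eval_X, eval_C, norm_mul, Complex.ofReal_mul]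
      ring

end UnitCircle

section UnitaryMatrix

variable {n : Type} [Fintype n] [DecidableEq n] {U : Matrix n n ℂ}

theorem norm_toEuclideanLin_of_mem_unitaryGroup (hU : U ∈ Matrix.unitaryGroup n ℂ)
    (ψ : EuclideanSpace ℂ n) : ‖Matrix.toEuclideanLin U ψ‖ = ‖ψ‖ := by
  have hadj : (Matrix.toEuclideanLin U).adjoint (Matrix.toEuclideanLin U ψ) = ψ := by
    rw [← Matrix.toEuclideanLin_conjTranspose_eq_adjoint, ← LinearMap.comp_apply,
      ← Matrix.toLpLin_mul_same, ← Matrix.star_eq_conjTranspose, Matrix.mem_unitaryGroup_iff'.1 hU,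
      Matrix.toLpLin_one, LinearMap.id_apply]
  rw [norm_eq_sqrt_re_inner (𝕜 := ℂ), ← LinearMap.adjoint_inner_left, hadj,
    ← norm_eq_sqrt_re_inner]

theorem sum_norm_sq_mulVec (hU : U ∈ Matrix.unitaryGroup n ℂ) (v : n → ℂ) :
    ∑ i, ‖(U *ᵥ v) i‖ ^ 2 = ∑ i, ‖v i‖ ^ 2 := by
  have h := congrArg (· ^ 2) (norm_toEuclideanLin_of_mem_unitaryGroup hU (WithLp.toLp 2 v))
  simp only [EuclideanSpace.norm_sq_eq] at h
  exact h

end UnitaryMatrix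

section OneQubit

open ComplexConjugate

/-- The bit flip. -/
def bitFlip : Matrix.unitaryGroup Bool ℂ :=
  ⟨Matrix.of fun i j => if i = !j then 1 else 0, by
    rw [Matrix.mem_unitaryGroup_iff]
    ext i j
    cases i <;> cases j <;> simp [Matrix.mul_apply]⟩

/-- A unitary with a given unit vector as its first column. -/
def columnUnitary (z : Bool → ℂ) (hz : ∑ i, ‖z i‖ ^ 2 = 1) : Matrix.unitaryGroup Bool ℂ :=
  ⟨Matrix.of fun i j => if j then (if i then conj (z false) else -conj (z true)) else z i, by
    have h : z true * conj (z true) + z false * conj (z false) = 1 := by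
      rw [Complex.mul_conj', Complex.mul_conj']
      exact_mod_cast (Fintype.sum_bool _).symm.trans hz
    rw [Matrix.mem_unitaryGroup_iff]
    ext i j
    cases i <;> cases j <;>
      simp only [Matrix.mul_apply, Matrix.star_apply, Matrix.of_apply, Fintype.sum_bool,
        Matrix.one_apply, reduceCtorEq, if_true, if_false, RCLike.star_def, map_neg,
        Complex.conj_conj, Bool.false_eq_true] <;>
      first | linear_combination h | ring1⟩

theorem columnUnitary_mulVec_single (z : Bool → ℂ) (hz : ∑ i, ‖z i‖ ^ 2 = 1) :
    (columnUnitary z hz).1 *ᵥ Pi.single false 1 = z := by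
  ext i
  simp [columnUnitary]

theorem exists_unitary_conjTranspose_mulVec_eq_single (x : Bool → ℂ) :
    ∃ (u : Matrix.unitaryGroup Bool ℂ) (c : ℂ), u.1ᴴ *ᵥ x = Pi.single false c := by
  rcases eq_or_ne x 0 with rfl | hx
  · exact ⟨1, 0, by simp⟩
  set r : ℝ := ‖WithLp.toLp 2 x‖ with hr
  have hr0 : r ≠ 0 := norm_ne_zero_iff.2 ((WithLp.toLp_eq_zero 2).not.2 hx)
  have hz : ∑ i, ‖((r : ℂ)⁻¹ • x) i‖ ^ 2 = 1 := by
    rw [← EuclideanSpace.norm_sq_eq (WithLp.toLp 2 ((r : ℂ)⁻¹ • x)), WithLp.toLp_smul, norm_smul,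
      ← hr, norm_inv, Complex.norm_real, hr, norm_norm, ← hr, inv_mul_cancel₀ hr0, one_pow]
  obtain ⟨u, hu⟩ : ∃ u : Matrix.unitaryGroup Bool ℂ,
      u.1 *ᵥ Pi.single false 1 = (r : ℂ)⁻¹ • x := ⟨_, columnUnitary_mulVec_single _ hz⟩
  refine ⟨u, r, ?_⟩
  rw [← smul_inv_smul₀ (Complex.ofReal_ne_zero.2 hr0) x, ← hu, Matrix.mulVec_smul,
    Matrix.mulVec_mulVec, ← Matrix.star_eq_conjTranspose, Matrix.mem_unitaryGroup_iff'.1 u.2,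
    Matrix.one_mulVec, ← Pi.single_smul, smul_eq_mul, mul_one]

theorem exists_unitary_axes {x y : Bool → ℂ} (h : star x ⬝ᵥ y = 0) :
    ∃ u : Matrix.unitaryGroup Bool ℂ, (u.1ᴴ *ᵥ x) true = 0 ∧ (u.1ᴴ *ᵥ y) false = 0 := by
  rcases eq_or_ne x 0 with rfl | hx
  · obtain ⟨u, c, hu⟩ := exists_unitary_conjTranspose_mulVec_eq_single y
    refine ⟨u * bitFlip, by simp, ?_⟩
    rw [Submonoid.coe_mul, Matrix.conjTranspose_mul, ← Matrix.mulVec_mulVec, hu]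
    simp [bitFlip]
  · obtain ⟨u, c, hu⟩ := exists_unitary_conjTranspose_mulVec_eq_single x
    have huu : u.1 * u.1ᴴ = 1 := Matrix.mem_unitaryGroup_iff.1 u.2
    have hc : c ≠ 0 := by
      rintro rfl
      refine hx ?_
      rw [← Matrix.one_mulVec x, ← huu, ← Matrix.mulVec_mulVec, hu, Pi.single_zero,
        Matrix.mulVec_zero]
    refine ⟨u, by simp [hu], ?_⟩
    have hdot : star (u.1ᴴ *ᵥ x) ⬝ᵥ (u.1ᴴ *ᵥ y) = 0 := by
      rw [Matrix.star_mulVec, Matrix.conjTranspose_conjTranspose, ← Matrix.dotProduct_mulVec,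
        Matrix.mulVec_mulVec, huu, Matrix.one_mulVec, h]
    rw [hu, ← Pi.single_star, single_dotProduct] at hdot
    exact (mul_eq_zero.1 hdot).resolve_left (star_ne_zero.2 hc)

end OneQubit

section SignalPolynomials

open Polynomial ComplexConjugate

/-- The polynomials generated by the one-qubit gates `A 0, …, A d`, interleaved with the operator
`diag (1, X)` and applied to `|0⟩`: the components of `A d * diag (1, X) * ⋯ * diag (1, X) * A 0`
applied to `|0⟩`. -/
def signalPoly (A : ℕ → Matrix.unitaryGroup Bool ℂ) : ℕ → Bool → ℂ[X]
  | 0 => fun i => C ((A 0).1 i false)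
  | d + 1 => (A (d + 1)).1.map C *ᵥ fun i => X ^ i.toNat * signalPoly A d i

theorem signalPoly_congr {A B : ℕ → Matrix.unitaryGroup Bool ℂ} {d : ℕ}
    (h : ∀ k ≤ d, A k = B k) : signalPoly A d = signalPoly B d := by
  induction d with
  | zero => simp only [signalPoly, h 0 le_rfl]
  | succ d ih =>
    simp only [signalPoly, h (d + 1) le_rfl, ih fun k hk => h k (hk.trans d.le_succ)]

/-- A pair of polynomials of degree at most `d` that is a unit vector at each point of the unit
circle: the pairs that quantum signal processing with `d` uses of the signal can produce. -/
structure IsUnitPair (d : ℕ) (P : Bool → ℂ[X]) : Prop where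
  natDegree_le : ∀ i, (P i).natDegree ≤ d
  sum_norm_sq : ∀ w : Circle, ∑ i, ‖(P i).eval (w : ℂ)‖ ^ 2 = 1

theorem coeff_map_C_mulVec (M : Matrix Bool Bool ℂ) (P : Bool → ℂ[X]) (i : Bool) (k : ℕ) :
    ((M.map C *ᵥ P) i).coeff k = (M *ᵥ fun j => (P j).coeff k) i := by
  simp [Matrix.mulVec, dotProduct]

theorem eval_map_C_mulVec (M : Matrix Bool Bool ℂ) (P : Bool → ℂ[X]) (i : Bool) (z : ℂ) :
    ((M.map C *ᵥ P) i).eval z = (M *ᵥ fun j => (P j).eval z) i := by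
  simp [Matrix.mulVec, dotProduct]

variable {d : ℕ} {P : Bool → ℂ[X]}

theorem IsUnitPair.star_coeff_zero_dotProduct_coeff (hP : IsUnitPair (d + 1) P) :
    star (fun i => (P i).coeff 0) ⬝ᵥ (fun i => (P i).coeff (d + 1)) = 0 := by
  have hprod : ∑ i, P i * conjReflect (d + 1) (P i) = X ^ (d + 1) := by
    refine eq_of_eval_circle fun w => ?_
    rw [eval_finsetSum, eval_X_pow]
    simp only [eval_circle_mul_conjReflect (hP.natDegree_le _), ← Finset.mul_sum]
    have hnorm : ∑ i, (‖(P i).eval (w : ℂ)‖ : ℂ) ^ 2 = 1 := by exact_mod_cast hP.sum_norm_sq w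
    rw [hnorm, mul_one]
  have hcoeff := congrArg (fun p => p.coeff ((d + 1) + (d + 1))) hprod
  simp only [finsetSum_coeff, coeff_mul_add_eq_of_natDegree_le (hP.natDegree_le _)
    (natDegree_conjReflect_le (hP.natDegree_le _)), coeff_self_conjReflect, coeff_X_pow] at hcoeff
  rw [if_neg (by lia)] at hcoeff
  simpa only [dotProduct, Pi.star_apply, RCLike.star_def, mul_comm] using hcoeff

theorem IsUnitPair.exists_layer (hP : IsUnitPair (d + 1) P) :
    ∃ (u : Matrix.unitaryGroup Bool ℂ) (Q : Bool → ℂ[X]), IsUnitPair d Q ∧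
      P = u.1.map C *ᵥ fun i => X ^ i.toNat * Q i := by
  obtain ⟨u, h_low, h_high⟩ := exists_unitary_axes hP.star_coeff_zero_dotProduct_coeff
  set R : Bool → ℂ[X] := u.1ᴴ.map C *ᵥ P with hR
  have hRdeg : ∀ i, (R i).natDegree ≤ d + 1 := fun i => by
    refine natDegree_le_iff_coeff_eq_zero.2 fun k hk => ?_
    have hcoeff : (fun j => (P j).coeff k) = 0 :=
      funext fun j => coeff_eq_zero_of_natDegree_lt ((hP.natDegree_le j).trans_lt hk)
    rw [hR, coeff_map_C_mulVec, hcoeff, Matrix.mulVec_zero, Pi.zero_apply]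
  have hPR : P = u.1.map C *ᵥ R := by
    rw [hR, Matrix.mulVec_mulVec, ← Matrix.map_mul, ← Matrix.star_eq_conjTranspose,
      Matrix.mem_unitaryGroup_iff.1 u.2, Matrix.map_one _ C_0 C_1, Matrix.one_mulVec]
  have hlow : (R true).coeff 0 = 0 := by rw [hR, coeff_map_C_mulVec, h_low]
  have hhigh : (R false).coeff (d + 1) = 0 := by rw [hR, coeff_map_C_mulVec, h_high]
  set Q : Bool → ℂ[X] := fun i => if i then (R true).divX else R false with hQ
  have hRQ : R = fun i => X ^ i.toNat * Q i := by
    ext1 i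
    cases i
    · simp [hQ]
    · simpa [hQ, hlow] using (X_mul_divX_add (R true)).symm
  refine ⟨u, Q, ⟨fun i => ?_, fun w => ?_⟩, hRQ ▸ hPR⟩
  · cases i
    · exact natDegree_le_pred (hRdeg false) hhigh
    · simpa [hQ, natDegree_divX_eq_natDegree_tsub_one] using hRdeg true
  · rw [← hP.sum_norm_sq w, hPR]
    simp only [eval_map_C_mulVec]
    rw [sum_norm_sq_mulVec u.2, hRQ]
    simp only [eval_mul, eval_pow, eval_X, norm_mul, norm_pow, Circle.norm_coe, one_pow, one_mul]

theorem IsUnitPair.exists_signalPoly_eq (hP : IsUnitPair d P) :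
    ∃ A : ℕ → Matrix.unitaryGroup Bool ℂ, signalPoly A d = P := by
  induction d generalizing P with
  | zero =>
    have hC : ∀ i, P i = C ((P i).coeff 0) := fun i =>
      eq_C_of_natDegree_le_zero (hP.natDegree_le i)
    have hunit : ∑ i, ‖(P i).coeff 0‖ ^ 2 = 1 := by
      rw [← hP.sum_norm_sq 1]
      exact Finset.sum_congr rfl fun i _ => by conv_rhs => rw [hC i, eval_C]
    refine ⟨fun _ => columnUnitary _ hunit, funext fun i => ?_⟩
    rw [hC i]
    simp [signalPoly, columnUnitary]
  | succ d ih =>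
    obtain ⟨u, Q, hQ, rfl⟩ := hP.exists_layer
    obtain ⟨A, rfl⟩ := ih hQ
    refine ⟨Function.update A (d + 1) u, ?_⟩
    rw [signalPoly, Function.update_self,
      signalPoly_congr fun k hk => Function.update_of_ne (Nat.lt_succ_of_le hk).ne u A]

/-- Fejér–Riesz applied to `1 - |p|²` completes `p` to a unit pair. -/
theorem exists_signalPoly {p : ℂ[X]} (hp : p.natDegree ≤ d)
    (h : ∀ w : Circle, ‖p.eval (w : ℂ)‖ < 1) :
    ∃ A : ℕ → Matrix.unitaryGroup Bool ℂ, signalPoly A d false = p := by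
  have heval : ∀ w : Circle, (X ^ d - p * conjReflect d p).eval (w : ℂ) =
      w ^ d * ((1 - ‖p.eval (w : ℂ)‖ ^ 2 : ℝ) : ℂ) := fun w => by
    rw [eval_sub, eval_X_pow, eval_circle_mul_conjReflect hp]
    push_cast
    ring
  have hpos : PosOnCircle d (X ^ d - p * conjReflect d p) := fun w =>
    ⟨_, sub_pos.2 (pow_lt_one₀ (norm_nonneg _) (h w) two_ne_zero), heval w⟩
  have hdeg : (X ^ d - p * conjReflect d p).natDegree ≤ 2 * d := by
    rw [two_mul]
    exact natDegree_sub_le_of_le ((natDegree_X_pow_le d).trans (Nat.le_add_left d d))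
      (natDegree_mul_le_of_le hp (natDegree_conjReflect_le hp)) |>.trans (max_self _).le
  obtain ⟨q, hq, hqeval⟩ := hpos.exists_norm_sq_eq hdeg
  have hpair : IsUnitPair d fun i => if i then q else p := by
    refine ⟨fun i => by cases i <;> simp [hp, hq], fun w => ?_⟩
    have hnorm : ((1 - ‖p.eval (w : ℂ)‖ ^ 2 : ℝ) : ℂ) = (‖q.eval (w : ℂ)‖ : ℂ) ^ 2 :=
      mul_left_cancel₀ (pow_ne_zero d w.coe_ne_zero) ((heval w).symm.trans (hqeval w))
    have hnorm' : 1 - ‖p.eval (w : ℂ)‖ ^ 2 = ‖q.eval (w : ℂ)‖ ^ 2 := by exact_mod_cast hnorm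
    simp [← hnorm']
  obtain ⟨A, hA⟩ := hpair.exists_signalPoly_eq
  exact ⟨A, by simp [hA]⟩

end SignalPolynomials

section Words

open Polynomial

variable {m n : Type} [Fintype m] [DecidableEq m] [Fintype n]

/-- The reflection about the range of the isometry `J`. -/
def reflection (J : Matrix m n ℂ) : Matrix m m ℂ := (2 : ℂ) • (J * Jᴴ) - 1

/-- The operator of one use of the block-encoding `U`, or of its adjoint if `adj`. -/
def queryOp (U : Matrix m m ℂ) (adj : Bool) : Matrix m m ℂ := if adj = true then Uᴴ else U

/-- The product of `k` alternating factors `U R` and `Uᴴ R`, where `R` is the reflection about the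
range of `J`; the rightmost factor is `U R`. -/
def word (J : Matrix m n ℂ) (U : Matrix m m ℂ) : ℕ → Matrix m m ℂ
  | 0 => 1
  | k + 1 => queryOp U k.bodd * (reflection J * word J U k)

/-- The square of the qubitization walk. Multiplication by it from the right shortens an alternating
product by two factors. -/
def walkSq (J : Matrix m n ℂ) (U : Matrix m m ℂ) : Matrix m m ℂ :=
  reflection J * (Uᴴ * (reflection J * U))

variable {J : Matrix m n ℂ} {U : Matrix m m ℂ}

theorem reflection_mul_add_self (A : Matrix m m ℂ) :
    reflection J * A + A = (2 : ℂ) • (J * (Jᴴ * A)) := by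
  rw [reflection, Matrix.sub_mul, Matrix.one_mul, sub_add_cancel, Matrix.smul_mul, Matrix.mul_assoc]

variable [DecidableEq n]

theorem reflection_mul_self (hJ : Jᴴ * J = 1) : reflection J * reflection J = 1 := by
  have projection_sq : (J * Jᴴ) * (J * Jᴴ) = J * Jᴴ := by
    rw [Matrix.mul_assoc, ← Matrix.mul_assoc Jᴴ, hJ, Matrix.one_mul]
  simp only [reflection, sub_mul, mul_sub, Matrix.smul_mul, Matrix.mul_smul, projection_sq,
    one_mul, mul_one]
  module

theorem reflection_mul_cancel (hJ : Jᴴ * J = 1) {l : Type} (A : Matrix m l ℂ) :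
    reflection J * (reflection J * A) = A := by
  rw [← Matrix.mul_assoc, reflection_mul_self hJ, Matrix.one_mul]

theorem conjTranspose_mul_reflection (hJ : Jᴴ * J = 1) : Jᴴ * reflection J = Jᴴ := by
  rw [reflection, Matrix.mul_sub, Matrix.mul_smul, ← Matrix.mul_assoc, hJ, Matrix.one_mul,
    Matrix.mul_one]
  module

theorem queryOp_not_mul (hU : U ∈ Matrix.unitaryGroup m ℂ) (b : Bool) :
    queryOp U (!b) * queryOp U b = 1 := by
  cases b
  · exact Matrix.mem_unitaryGroup_iff'.1 hU
  · exact Matrix.mem_unitaryGroup_iff.1 hU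

theorem queryOp_not_mul_cancel (hU : U ∈ Matrix.unitaryGroup m ℂ) (b : Bool) {l : Type}
    (A : Matrix m l ℂ) : queryOp U (!b) * (queryOp U b * A) = A := by
  rw [← Matrix.mul_assoc, queryOp_not_mul hU, Matrix.one_mul]

theorem reflection_queryOp_word (hJ : Jᴴ * J = 1) (hU : U ∈ Matrix.unitaryGroup m ℂ) (k : ℕ) :
    reflection J * (queryOp U k.bodd * word J U k) = word J U (k + 1) * walkSq J U := by
  induction k with
  | zero =>
    have h := queryOp_not_mul_cancel hU true (reflection J * U)
    simp only [queryOp, Bool.not_true, Bool.false_eq_true, if_false, if_true] at h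
    simp [word, walkSq, queryOp, Matrix.mul_assoc, reflection_mul_cancel hJ, h]
  | succ k ih =>
    rw [word.eq_2 J U (k + 1), Matrix.mul_assoc, Matrix.mul_assoc (reflection J), ← ih,
      reflection_mul_cancel hJ, word, Nat.bodd_succ, queryOp_not_mul_cancel hU,
      queryOp_not_mul_cancel hU, reflection_mul_cancel hJ]

theorem word_mul_walkSq (hJ : Jᴴ * J = 1) (hU : U ∈ Matrix.unitaryGroup m ℂ) (k : ℕ) :
    word J U (k + 2) * walkSq J U = word J U k := by
  rw [← reflection_queryOp_word hJ hU, word, Nat.bodd_succ, queryOp_not_mul_cancel hU,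
    reflection_mul_cancel hJ]

theorem word_mul_walkSq_pow (hJ : Jᴴ * J = 1) (hU : U ∈ Matrix.unitaryGroup m ℂ) (j : ℕ) :
    word J U (2 * j) * walkSq J U ^ j = 1 := by
  induction j with
  | zero => simp [word]
  | succ j ih => rw [pow_succ', ← Matrix.mul_assoc, mul_add, mul_one, word_mul_walkSq hJ hU, ih]

theorem block_word_succ (hJ : Jᴴ * J = 1) (hU : U ∈ Matrix.unitaryGroup m ℂ) (k : ℕ) :
    Jᴴ * (word J U (k + 1) * ((1 / 2 : ℂ) • (1 + walkSq J U))) =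
      (Jᴴ * (queryOp U k.bodd * J)) * (Jᴴ * word J U k) := by
  rw [Matrix.mul_smul, Matrix.mul_add, Matrix.mul_one, ← reflection_queryOp_word hJ hU, word,
    Matrix.mul_smul, Matrix.mul_add, ← Matrix.mul_assoc Jᴴ (reflection J),
    conjTranspose_mul_reflection hJ, ← Matrix.mul_add, ← Matrix.mul_add, reflection_mul_add_self]
  simp only [Matrix.mul_smul, smul_smul, Matrix.mul_assoc]
  norm_num

theorem block_word_pow (hJ : Jᴴ * J = 1) (hU : U ∈ Matrix.unitaryGroup m ℂ) {α : ℂ}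
    {H : Matrix n n ℂ} (hH : ∀ b, α • (Jᴴ * (queryOp U b * J)) = H) (j k : ℕ) :
    α ^ k • (Jᴴ * (word J U (2 * j + k) *
      (walkSq J U ^ j * ((1 / 2 : ℂ) • (1 + walkSq J U)) ^ k))) = H ^ k * Jᴴ := by
  induction k with
  | zero => simp [word_mul_walkSq_pow hJ hU]
  | succ k ih =>
    have pow_comm : Commute (walkSq J U ^ j) ((1 / 2 : ℂ) • (1 + walkSq J U)) :=
      (((Commute.one_right _).add_right (Commute.refl _)).smul_right _).pow_left _
    rw [pow_succ' ((1 / 2 : ℂ) • (1 + walkSq J U)), ← mul_assoc (walkSq J U ^ j), pow_comm.eq,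
      mul_assoc, ← add_assoc, ← Matrix.mul_assoc (word J U _), ← Matrix.mul_assoc Jᴴ,
      block_word_succ hJ hU, pow_succ' H, Matrix.mul_assoc H, ← ih, ← hH (2 * j + k).bodd]
    simp only [Matrix.mul_smul, Matrix.smul_mul, smul_smul, Matrix.mul_assoc, pow_succ]

/-- The part of parity `par` of the truncated Taylor series of `s * exp (-i τ x)` with `2 n` terms,
for `x = (z + 1 / z) / 2`, multiplied by `z ^ (2 * (n - 1) + par)`, as a polynomial in `z ^ 2`. -/
def expPoly (s τ : ℂ) (n par : ℕ) : ℂ[X] :=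
  ∑ i ∈ Finset.range n, C (s * (-(Complex.I * τ)) ^ (2 * i + par) / (2 * i + par).factorial) *
    (X ^ (n - 1 - i) * (C (1 / 2) * (1 + X)) ^ (2 * i + par))

theorem natDegree_expPoly_le (s τ : ℂ) (n par : ℕ) :
    (expPoly s τ n par).natDegree ≤ 2 * (n - 1) + par := by
  refine natDegree_sum_le_of_forall_le _ _ fun i hi => ?_
  have hi' := Finset.mem_range.1 hi
  have natDegree_half_le : (C (1 / 2 : ℂ) * (1 + X)).natDegree ≤ 1 := by
    compute_degree
  have natDegree_pow_le := natDegree_pow_le_of_le (2 * i + par) natDegree_half_le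
  refine (natDegree_C_mul_le _ _).trans (natDegree_mul_le.trans ?_)
  rw [natDegree_X_pow]
  lia

theorem block_expPoly (hJ : Jᴴ * J = 1) (hU : U ∈ Matrix.unitaryGroup m ℂ) {α : ℂ}
    {H : Matrix n n ℂ} (hH : ∀ b, α • (Jᴴ * (queryOp U b * J)) = H) (s t : ℂ) (N par : ℕ) :
    Jᴴ * (word J U (2 * (N - 1) + par) * aeval (walkSq J U) (expPoly s (α * t) N par)) =
      s • ((∑ i ∈ Finset.range N, ((2 * i + par).factorial : ℂ)⁻¹ •
        ((-(Complex.I * t)) • H) ^ (2 * i + par)) * Jᴴ) := by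
  simp only [expPoly, map_sum, Matrix.mul_sum, Matrix.sum_mul, Finset.smul_sum]
  refine Finset.sum_congr rfl fun i hi => ?_
  have hi' := Finset.mem_range.1 hi
  have block_pow := block_word_pow hJ hU hH (N - 1 - i) (2 * i + par)
  rw [show 2 * (N - 1 - i) + (2 * i + par) = 2 * (N - 1) + par by lia] at block_pow
  have aeval_half : aeval (walkSq J U) (C (1 / 2 : ℂ) * (1 + X)) =
      (1 / 2 : ℂ) • (1 + walkSq J U) := by
    simp [Algebra.smul_def]
  rw [map_mul, aeval_C, map_mul, map_pow, map_pow, aeval_half, aeval_X, ← Algebra.smul_def,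
    _root_.smul_pow (-(Complex.I * t)) H, Matrix.smul_mul, Matrix.smul_mul, ← block_pow,
    Matrix.mul_smul, Matrix.mul_smul, smul_smul, smul_smul, smul_smul]
  congr 1
  rw [show -(Complex.I * (α * t)) = -(Complex.I * t) * α by ring, mul_pow]
  ring

end Words

section Taylor

theorem norm_exp_sub_sum_le_exp_sub_sum {𝔸 : Type*} [NormedRing 𝔸] [NormedAlgebra ℂ 𝔸]
    [CompleteSpace 𝔸] {A : 𝔸} {τ : ℝ} (hA : ‖A‖ ≤ τ) {N : ℕ} (hN : 0 < N) :
    ‖NormedSpace.exp A - ∑ k ∈ Finset.range N, (k.factorial : ℂ)⁻¹ • A ^ k‖ ≤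
      Real.exp τ - ∑ k ∈ Finset.range N, τ ^ k / (k.factorial : ℝ) := by
  have summable_real := Real.summable_pow_div_factorial τ
  have exp_tail : NormedSpace.exp A - ∑ k ∈ Finset.range N, (k.factorial : ℂ)⁻¹ • A ^ k =
      ∑' k : ℕ, ((k + N).factorial : ℂ)⁻¹ • A ^ (k + N) := by
    rw [congrFun (NormedSpace.exp_eq_tsum ℂ) A,
      ← (NormedSpace.expSeries_summable' (𝕂 := ℂ) A).sum_add_tsum_nat_add N, add_sub_cancel_left]
  have real_tail : Real.exp τ - ∑ k ∈ Finset.range N, τ ^ k / (k.factorial : ℝ) =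
      ∑' k : ℕ, τ ^ (k + N) / ((k + N).factorial : ℝ) := by
    rw [Real.exp_eq_exp_ℝ, congrFun NormedSpace.exp_eq_tsum_div τ,
      ← summable_real.sum_add_tsum_nat_add N, add_sub_cancel_left]
  rw [exp_tail, real_tail]
  refine tsum_of_norm_bounded ((summable_nat_add_iff N).2 summable_real).hasSum fun k => ?_
  rw [norm_smul, norm_inv, Complex.norm_natCast, div_eq_inv_mul]
  gcongr
  exact (norm_pow_le' A (by lia)).trans (pow_le_pow_left₀ (norm_nonneg _) hA _)

theorem exp_sub_sum_range_le {τ : ℝ} (hτ0 : 0 ≤ τ) {N : ℕ} (hτ : τ / (N + 1 : ℕ) ≤ 1 / 2) :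
    Real.exp τ - ∑ k ∈ Finset.range N, τ ^ k / (k.factorial : ℝ) ≤ 2 * (τ ^ N / N.factorial) := by
  have norm_eq : ‖(τ : ℂ)‖ = τ := by rw [Complex.norm_real, Real.norm_of_nonneg hτ0]
  have complex_bound := Complex.exp_bound' (x := (τ : ℂ)) (n := N) (by rwa [norm_eq])
  have remainder_eq : Complex.exp (τ : ℂ) - ∑ k ∈ Finset.range N, (τ : ℂ) ^ k / (k.factorial : ℂ) =
      ((Real.exp τ - ∑ k ∈ Finset.range N, τ ^ k / (k.factorial : ℝ) : ℝ) : ℂ) := by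
    push_cast
    rfl
  rw [norm_eq, remainder_eq, Complex.norm_real] at complex_bound
  exact ((Real.le_norm_self _).trans complex_bound).trans_eq (mul_comm _ _)

theorem norm_exp_sub_sum_le {𝔸 : Type*} [NormedRing 𝔸] [NormedAlgebra ℂ 𝔸] [CompleteSpace 𝔸]
    {A : 𝔸} {τ : ℝ} (hA : ‖A‖ ≤ τ) {N : ℕ} (hN : 0 < N) (hτ : τ / (N + 1 : ℕ) ≤ 1 / 2) :
    ‖NormedSpace.exp A - ∑ k ∈ Finset.range N, (k.factorial : ℂ)⁻¹ • A ^ k‖ ≤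
      2 * (τ ^ N / N.factorial) :=
  (norm_exp_sub_sum_le_exp_sub_sum hA hN).trans
    (exp_sub_sum_range_le ((norm_nonneg A).trans hA) hτ)

theorem sum_range_two_mul {M : Type*} [AddCommMonoid M] (f : ℕ → M) (n : ℕ) :
    ∑ k ∈ Finset.range (2 * n), f k =
      ∑ i ∈ Finset.range n, f (2 * i) + ∑ i ∈ Finset.range n, f (2 * i + 1) := by
  induction n with
  | zero => simp
  | succ n ih =>
    rw [mul_add, mul_one, Finset.sum_range_succ, Finset.sum_range_succ, ih,
      Finset.sum_range_succ, Finset.sum_range_succ]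
    abel

-- Consecutive terms of the series have ratios `u ≤ 1` and `v ≤ 1 / 2`, so the two terms before the
-- one of degree `2 (k + 1)` are together at least four times as large.
theorem five_mul_pow_div_factorial_le_exp {y : ℝ} {k : ℕ} (hy0 : 0 ≤ y) (hy : y ≤ k + 1) :
    5 * (y ^ (2 * (k + 1)) / (2 * (k + 1)).factorial) ≤ Real.exp y := by
  set c := y ^ (2 * k) / ((2 * k).factorial : ℝ)
  set u := y / (2 * k + 1 : ℝ)
  set v := y / (2 * k + 2 : ℝ)
  have term_succ : y ^ (2 * k + 1) / ((2 * k + 1).factorial : ℝ) = c * u := by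
    simp only [Nat.factorial_succ, pow_succ y, Nat.cast_mul, c, u]
    push_cast
    field_simp
  have term_succ_succ : y ^ (2 * k + 2) / ((2 * k + 2).factorial : ℝ) = c * (u * v) := by
    simp only [Nat.factorial_succ, pow_succ y, Nat.cast_mul, c, u, v]
    push_cast
    field_simp
    ring
  have hc : 0 ≤ c := by positivity
  have hu0 : 0 ≤ u := by positivity
  have hu : u ≤ 1 := div_le_one_of_le₀ (by linarith [k.cast_nonneg (α := ℝ)]) (by positivity)
  have hv : v ≤ 1 / 2 := by
    rw [div_le_iff₀ (by positivity)]
    linarith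
  have ratio_bound : 5 * (u * v) ≤ 1 + u + u * v := by nlinarith
  have partial_sum_le := Real.sum_le_exp_of_nonneg hy0 (2 * k + 3)
  rw [Finset.sum_range_succ, Finset.sum_range_succ, Finset.sum_range_succ, term_succ,
    term_succ_succ] at partial_sum_le
  have head_nonneg : 0 ≤ ∑ i ∈ Finset.range (2 * k), y ^ i / (i.factorial : ℝ) :=
    Finset.sum_nonneg fun i _ => by positivity
  calc 5 * (y ^ (2 * (k + 1)) / (2 * (k + 1)).factorial)
      = c * (5 * (u * v)) := by rw [show 2 * (k + 1) = 2 * k + 2 by ring, term_succ_succ]; ring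
    _ ≤ c * (1 + u + u * v) := mul_le_mul_of_nonneg_left ratio_bound hc
    _ ≤ Real.exp y := by linarith

theorem mul_exp_natCast_le_pow {n : ℕ} (hn : 1 ≤ n) :
    2.8 * Real.exp n ≤ (2.8 : ℝ) ^ (2 * n) := by
  obtain ⟨k, rfl⟩ := Nat.exists_eq_add_of_le' hn
  have exp_one_le : Real.exp 1 ≤ 2.8 := by linarith [Real.exp_one_lt_d9]
  calc 2.8 * Real.exp (k + 1 : ℕ)
      = 2.8 * (Real.exp 1 ^ k * Real.exp 1) := by rw [← Real.exp_one_pow, pow_succ]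
    _ ≤ 2.8 * ((2.8 ^ 2) ^ k * 2.8) := by
        gcongr
        exact exp_one_le.trans (by norm_num)
    _ = 2.8 ^ (2 * (k + 1)) := by rw [← pow_mul]; ring

theorem taylor_remainder_le {τ ε : ℝ} {n : ℕ} (hτ : 0 ≤ τ) (hε : 0 < ε) (hε1 : ε ≤ 1) (hn : 1 ≤ n)
    (h : 2.8 * τ + Real.log (1 / ε) ≤ n) :
    2 * (τ ^ (2 * n) / (2 * n).factorial) ≤ ε / 7 := by
  have hlog : 0 ≤ Real.log (1 / ε) := Real.log_nonneg ((one_le_div hε).2 hε1)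
  have exp_le : Real.exp (2.8 * τ) ≤ ε * Real.exp n := by
    rw [one_div, Real.log_inv] at h
    calc Real.exp (2.8 * τ) ≤ Real.exp (Real.log ε + n) := Real.exp_le_exp.2 (by linarith)
      _ = ε * Real.exp n := by rw [Real.exp_add, Real.exp_log hε]
  have five_le : 5 * ((2.8 * τ) ^ (2 * n) / (2 * n).factorial) ≤ Real.exp (2.8 * τ) := by
    obtain ⟨k, rfl⟩ := Nat.exists_eq_add_of_le' hn
    exact five_mul_pow_div_factorial_le_exp (by positivity) (by push_cast at h; linarith)
  set T := τ ^ (2 * n) / ((2 * n).factorial : ℝ)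
  have scaled : 14 * T * Real.exp n ≤ ε * Real.exp n :=
    calc 14 * T * Real.exp n
        = 5 * (2.8 * Real.exp n * T) := by ring
      _ ≤ 5 * (2.8 ^ (2 * n) * T) := by gcongr; exact mul_exp_natCast_le_pow hn
      _ = 5 * ((2.8 * τ) ^ (2 * n) / (2 * n).factorial) := by rw [mul_pow, mul_div_assoc]
      _ ≤ ε * Real.exp n := five_le.trans exp_le
  linarith [le_of_mul_le_mul_right scaled (Real.exp_pos _)]

/-- The terms of one parity of the exponential series of `y`, truncated after `2 n` terms. -/
def expParityPart (y : ℂ) (n par : ℕ) : ℂ :=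
  ∑ i ∈ Finset.range n, y ^ (2 * i + par) / ((2 * i + par).factorial : ℂ)

theorem sum_range_pow_div_factorial (y : ℂ) (n : ℕ) :
    ∑ k ∈ Finset.range (2 * n), y ^ k / (k.factorial : ℂ) =
      expParityPart y n 0 + expParityPart y n 1 :=
  sum_range_two_mul _ _

theorem expParityPart_neg (y : ℂ) (n par : ℕ) :
    expParityPart (-y) n par = (-1) ^ par * expParityPart y n par := by
  rw [expParityPart, expParityPart, Finset.mul_sum]
  refine Finset.sum_congr rfl fun i _ => ?_
  rw [neg_pow, pow_add (-1 : ℂ), pow_mul, neg_one_sq, one_pow, one_mul, mul_div_assoc]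

theorem norm_expParityPart_le {y : ℂ} {n : ℕ} {B : ℝ}
    (h : ‖∑ k ∈ Finset.range (2 * n), y ^ k / (k.factorial : ℂ)‖ ≤ B)
    (h' : ‖∑ k ∈ Finset.range (2 * n), (-y) ^ k / (k.factorial : ℂ)‖ ≤ B) (par : Bool) :
    ‖expParityPart y n par.toNat‖ ≤ B := by
  rw [sum_range_pow_div_factorial] at h h'
  rw [expParityPart_neg, expParityPart_neg, pow_zero, one_mul, pow_one, neg_one_mul] at h'
  have le_of_two_mul (z : ℂ) (hz : ‖2 * z‖ ≤ B + B) : ‖z‖ ≤ B := by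
    rw [norm_mul, Complex.norm_ofNat] at hz
    linarith
  refine le_of_two_mul _ ?_
  cases par
  · refine le_of_eq_of_le (congrArg norm ?_) ((norm_add_le _ _).trans (add_le_add h h'))
    rw [Bool.toNat_false]
    ring
  · refine le_of_eq_of_le (congrArg norm ?_) ((norm_sub_le _ _).trans (add_le_add h h'))
    rw [Bool.toNat_true]
    ring

theorem norm_sum_range_exp_mul_I_le {τ x δ : ℝ} {N : ℕ} (hN : 0 < N) (hx : |x| ≤ τ)
    (hτ : τ / (N + 1 : ℕ) ≤ 1 / 2) (hδ : 2 * (τ ^ N / N.factorial) ≤ δ) :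
    ‖∑ k ∈ Finset.range N, (x * Complex.I) ^ k / (k.factorial : ℂ)‖ ≤ 1 + δ := by
  have norm_le : ‖x * Complex.I‖ ≤ τ := by
    rwa [norm_mul, Complex.norm_I, mul_one, Complex.norm_real]
  have remainder_le := norm_exp_sub_sum_le norm_le hN hτ
  simp only [← Complex.exp_eq_exp_ℂ, smul_eq_mul, inv_mul_eq_div] at remainder_le
  rw [norm_sub_rev] at remainder_le
  have := norm_le_norm_add_norm_sub' (∑ k ∈ Finset.range N, (x * Complex.I) ^ k / (k.factorial : ℂ))
    (Complex.exp (x * Complex.I))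
  rw [Complex.norm_exp_ofReal_mul_I] at this
  linarith

open Polynomial in
theorem eval_expPoly (s τ : ℂ) {z x : ℂ} (hzx : (1 / 2 : ℂ) * (1 + z ^ 2) = z * x) (n par : ℕ) :
    (expPoly s τ n par).eval (z ^ 2) =
      z ^ (2 * (n - 1) + par) * (s * expParityPart (-(Complex.I * τ) * x) n par) := by
  rw [expPoly, expParityPart, eval_finsetSum, Finset.mul_sum, Finset.mul_sum]
  refine Finset.sum_congr rfl fun i hi => ?_
  have hi' := Finset.mem_range.1 hi
  simp only [eval_mul, eval_C, eval_pow, eval_X, eval_add, eval_one]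
  rw [hzx, mul_pow z, ← mul_assoc ((z ^ 2) ^ _), ← pow_mul, ← pow_add,
    show 2 * (n - 1 - i) + (2 * i + par) = 2 * (n - 1) + par by lia, mul_pow (-(Complex.I * τ))]
  ring

theorem half_one_add_sq_circle (z : Circle) :
    (1 / 2 : ℂ) * (1 + (z : ℂ) ^ 2) = z * ((z : ℂ).re : ℂ) := by
  rw [Complex.re_eq_add_conj]
  linear_combination (-1 / 2 : ℂ) * circle_mul_conj z

open Polynomial in
theorem norm_eval_expPoly_lt {s τ δ : ℝ} {n : ℕ} (hn : 1 ≤ n) (hτ : 0 ≤ τ)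
    (hτn : τ / (2 * n + 1 : ℕ) ≤ 1 / 2) (hδ : 2 * (τ ^ (2 * n) / (2 * n).factorial) ≤ δ)
    (hs0 : 0 ≤ s) (hs : s * (1 + δ) < 1) (par : Bool) (w : Circle) :
    ‖(expPoly s τ n par.toNat).eval (w : ℂ)‖ < 1 := by
  obtain ⟨z, rfl⟩ : ∃ z : Circle, z ^ 2 = w := ⟨Circle.exp (Complex.arg w / 2), by
    rw [sq, ← Circle.exp_add, add_halves, Circle.exp_arg]⟩
  set x := (z : ℂ).re
  have hx : |τ * x| ≤ τ := by
    rw [abs_mul, abs_of_nonneg hτ]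
    exact mul_le_of_le_one_right hτ ((Complex.abs_re_le_norm z).trans_eq z.norm_coe)
  have parity_le : ‖expParityPart (-(Complex.I * τ) * x) n par.toNat‖ ≤ 1 + δ := by
    refine norm_expParityPart_le ?_ ?_ par
    · rw [show -(Complex.I * τ) * x = ((-(τ * x) : ℝ) : ℂ) * Complex.I by push_cast; ring]
      exact norm_sum_range_exp_mul_I_le (by lia) (by rwa [abs_neg]) hτn hδ
    · rw [show -(-(Complex.I * τ) * x) = ((τ * x : ℝ) : ℂ) * Complex.I by push_cast; ring]
      exact norm_sum_range_exp_mul_I_le (by lia) hx hτn hδ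
  rw [Circle.coe_pow, eval_expPoly _ _ (half_one_add_sq_circle z), norm_mul, norm_pow, z.norm_coe,
    one_pow, one_mul, norm_mul, Complex.norm_real, Real.norm_of_nonneg hs0]
  exact (mul_le_mul_of_nonneg_left parity_le hs0).trans_lt hs

end Taylor

section Evolution

variable {s : ℕ}

theorem evolution_mem_unitaryGroup {H : QOp (Fin s)} (hH : H.IsHermitian) (t : ℝ) :
    evolution H t ∈ Matrix.unitaryGroup (Fin s → Bool) ℂ := by
  have skew : -(Complex.I * (t : ℂ)) ∈ skewAdjoint ℂ := by
    rw [skewAdjoint.mem_iff]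
    simp
  let _ : NormedAlgebra ℚ (QOp (Fin s)) := NormedAlgebra.restrictScalars ℚ ℂ _
  exact NormedSpace.exp_mem_unitary_of_mem_skewAdjoint
    (IsSelfAdjoint.smul_mem_skewAdjoint skew hH)

/-- The Taylor series of `exp (-i H t)` truncated after `2 n` terms, which the simulation circuits
implement exactly up to a scalar. -/
def taylorEvolution (H : QOp (Fin s)) (t : ℝ) (n : ℕ) : QOp (Fin s) :=
  ∑ k ∈ Finset.range (2 * n), (k.factorial : ℂ)⁻¹ • ((-(Complex.I * (t : ℂ))) • H) ^ k

theorem norm_evolution_sub_taylor_le {n : ℕ} {H : QOp (Fin s)} {α t : ℝ} (hα : ‖H‖ ≤ α)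
    (ht : 0 ≤ t) (hn : 1 ≤ n) (hτ : α * t / (2 * n + 1 : ℕ) ≤ 1 / 2) :
    ‖evolution H t - taylorEvolution H t n‖ ≤ 2 * ((α * t) ^ (2 * n) / (2 * n).factorial) := by
  refine norm_exp_sub_sum_le ?_ (by lia) hτ
  rw [norm_smul, norm_neg, norm_mul, Complex.norm_I, one_mul, Complex.norm_real,
    Real.norm_of_nonneg ht, mul_comm]
  exact mul_le_mul_of_nonneg_right hα ht

end Evolution

section Embed

variable {X Y Z : Type} [DecidableEq Y]

/-- The matrix that maps the basis vector `z` to the basis vector `g z`. -/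
def embed (g : Z → Y) : Matrix Y Z ℂ := Matrix.of fun y z => if y = g z then 1 else 0

theorem mul_embed [Fintype Y] (A : Matrix X Y ℂ) (g : Z → Y) :
    A * embed g = A.submatrix id g := by
  ext x z
  simp [Matrix.mul_apply, embed]

theorem conjTranspose_embed_mul [Fintype Y] (g : Z → Y) (A : Matrix Y X ℂ) :
    (embed g)ᴴ * A = A.submatrix g id := by
  ext x z
  simp [Matrix.mul_apply, embed, Matrix.conjTranspose_apply, apply_ite (starRingEnd ℂ)]

theorem diagonal_mul_embed [Fintype Y] [Fintype Z] [DecidableEq Z] (d : Y → ℂ) (g : Z → Y) :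
    Matrix.diagonal d * embed g = embed g * Matrix.diagonal fun z => d (g z) := by
  ext y z
  rw [Matrix.diagonal_mul, Matrix.mul_diagonal, embed, Matrix.of_apply]
  split_ifs with h
  · rw [h, mul_comm]
  · simp

theorem embed_isometry [Fintype Y] [DecidableEq Z] {g : Z → Y} (hg : Function.Injective g) :
    (embed g)ᴴ * embed g = 1 := by
  rw [mul_embed]
  ext x z
  simp [Matrix.conjTranspose_apply, embed, Matrix.one_apply, hg.eq_iff,
    apply_ite (starRingEnd ℂ), eq_comm]

theorem embed_mul_embed [Fintype Y] {W : Type} [DecidableEq W] (h : Y → W) (g : Z → Y) :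
    embed h * embed g = embed (h ∘ g) := by
  rw [mul_embed]
  rfl

end Embed

section Subregisters

/-- A part of a register: its basis state, in `E`, can be read off and replaced in a basis state of
the whole register, in `X`, subject to the laws of a lens. -/
structure Subregister (X E : Type) where
  get : X → E
  set : X → E → X
  get_set : ∀ x e, get (set x e) = e
  set_get : ∀ x, set x (get x) = x
  set_set : ∀ x e e', set (set x e) e' = set x e'

namespace Subregister

variable {X E : Type} (L : Subregister X E)

theorem eq_set_comm {x y : X} : x = L.set y (L.get x) ↔ y = L.set x (L.get y) := by
  have swap : ∀ {x y : X}, x = L.set y (L.get x) → y = L.set x (L.get y) := fun {x y} h => by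
    rw [h, L.set_set, L.set_get]
  exact ⟨swap, swap⟩

variable [DecidableEq X]

/-- The operator that acts on the part `L` of the register, in a way `k` that may depend on the rest
of the register. It is meaningful if `k` does not depend on the part `L` itself. -/
def op (k : X → Matrix E E ℂ) : Matrix X X ℂ :=
  Matrix.of fun x y => if x = L.set y (L.get x) then k y (L.get x) (L.get y) else 0

theorem op_apply (k : X → Matrix E E ℂ) (x y : X) :
    L.op k x y = if x = L.set y (L.get x) then k y (L.get x) (L.get y) else 0 := rfl

theorem conjTranspose_op {k : X → Matrix E E ℂ} (hk : ∀ x e, k (L.set x e) = k x) :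
    (L.op k)ᴴ = L.op fun x => (k x)ᴴ := by
  ext x y
  rw [Matrix.conjTranspose_apply, op_apply, op_apply]
  by_cases h : x = L.set y (L.get x)
  · have same_rest : k x = k y := by rw [h, hk]
    rw [if_pos h, if_pos (L.eq_set_comm.1 h), same_rest, Matrix.conjTranspose_apply]
  · rw [if_neg h, if_neg (mt L.eq_set_comm.2 h), star_zero]

theorem op_diagonal [DecidableEq E] (d : X → E → ℂ) :
    L.op (fun x => Matrix.diagonal (d x)) = Matrix.diagonal fun x => d x (L.get x) := by
  ext x y
  rw [op_apply, Matrix.diagonal_apply, Matrix.diagonal_apply, ← ite_and]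
  have h : (x = L.set y (L.get x) ∧ L.get x = L.get y) ↔ x = y :=
    ⟨fun h => by rw [h.1, h.2, L.set_get], fun h => by rw [h, L.set_get]; exact ⟨rfl, rfl⟩⟩
  by_cases hxy : x = y
  · rw [if_pos (h.2 hxy), if_pos hxy, hxy]
  · rw [if_neg (h.not.2 hxy), if_neg hxy]

theorem op_one [DecidableEq E] : L.op (fun _ => 1) = 1 := by
  simpa only [Matrix.diagonal_one] using L.op_diagonal fun _ _ => 1

theorem op_mul_embed_of_classical [Fintype X] [DecidableEq E] {Z : Type} {k : X → Matrix E E ℂ}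
    {g : Z → X} {v : Z → E} (hv : ∀ z e, k (g z) e (L.get (g z)) = if e = v z then 1 else 0) :
    L.op k * embed g = embed fun z => L.set (g z) (v z) := by
  rw [mul_embed]
  ext x z
  have h : (x = L.set (g z) (L.get x) ∧ L.get x = v z) ↔ x = L.set (g z) (v z) :=
    ⟨fun h => by rw [← h.2, ← h.1], fun h => by rw [h, L.get_set]; exact ⟨rfl, rfl⟩⟩
  rw [Matrix.submatrix_apply, id, op_apply, hv, embed, Matrix.of_apply, ← ite_and]
  exact if_congr h rfl rfl

variable [Fintype E]

theorem op_apply_eq_sum (k : X → Matrix E E ℂ) (x y : X) :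
    L.op k x y = ∑ e, k y e (L.get y) * if x = L.set y e then 1 else 0 := by
  rw [Finset.sum_eq_single (L.get x), op_apply, mul_ite, mul_one, mul_zero]
  · intro e _ he
    rw [if_neg, mul_zero]
    rintro rfl
    exact he (L.get_set y e).symm
  · exact fun h => absurd (Finset.mem_univ _) h

variable [Fintype X]

theorem mul_op_apply {Y : Type} (A : Matrix Y X ℂ) (k : X → Matrix E E ℂ) (x : Y) (z : X) :
    (A * L.op k) x z = ∑ e, k z e (L.get z) * A x (L.set z e) := by
  simp only [Matrix.mul_apply, op_apply_eq_sum, Finset.mul_sum]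
  rw [Finset.sum_comm]
  simp [mul_comm]

theorem op_mul_embed_set {k : X → Matrix E E ℂ} (hk : ∀ x e, k (L.set x e) = k x) (x : X) :
    L.op k * embed (L.set x) = embed (L.set x) * k x := by
  rw [mul_embed]
  ext y e
  rw [Matrix.submatrix_apply, id, op_apply_eq_sum, hk, L.get_set]
  simp only [L.set_set, Matrix.mul_apply, embed, Matrix.of_apply, mul_comm]

theorem op_mul_embed {Z : Type} {k : X → Matrix E E ℂ} {g : Z → X} {M : Matrix E E ℂ} {e : E}
    (hM : ∀ z, k (g z) = M) (he : ∀ z, L.get (g z) = e) :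
    L.op k * embed g = ∑ e', M e' e • embed fun z => L.set (g z) e' := by
  rw [mul_embed]
  ext x z
  simp only [Matrix.submatrix_apply, id, op_apply_eq_sum, hM, he, Matrix.sum_apply,
    Matrix.smul_apply, smul_eq_mul, embed, Matrix.of_apply]

theorem op_mul_op {k : X → Matrix E E ℂ} (hk : ∀ x e, k (L.set x e) = k x)
    (k' : X → Matrix E E ℂ) : L.op k * L.op k' = L.op fun x => k x * k' x := by
  ext x z
  rw [mul_op_apply]
  simp only [op_apply, L.set_set, L.get_set, hk, Matrix.mul_apply, mul_comm (k' _ _ _)]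
  split_ifs <;> simp

theorem op_mem_unitaryGroup [DecidableEq E] {k : X → Matrix E E ℂ} (hk : ∀ x e, k (L.set x e) = k x)
    (hu : ∀ x, k x ∈ Matrix.unitaryGroup E ℂ) : L.op k ∈ Matrix.unitaryGroup X ℂ := by
  have inverse : ∀ x, (k x)ᴴ * k x = 1 := fun x => Matrix.mem_unitaryGroup_iff'.1 (hu x)
  rw [Matrix.mem_unitaryGroup_iff', Matrix.star_eq_conjTranspose, L.conjTranspose_op hk,
    L.op_mul_op fun x e => by rw [hk]]
  simp only [inverse, op_one]

end Subregister

/-- The second of two subsystems. -/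
def sndSubregister (A E : Type) : Subregister (A × E) E where
  get x := x.2
  set x e := (x.1, e)
  get_set _ _ := rfl
  set_get _ := rfl
  set_set _ _ _ := rfl

variable {ι : Type} [DecidableEq ι]

/-- A single qubit. -/
def qubit (q : ι) : Subregister (ι → Bool) Bool where
  get x := x q
  set x e := Function.update x q e
  get_set _ _ := Function.update_self ..
  set_get _ := Function.update_eq_self ..
  set_set _ _ _ := Function.update_idem ..

theorem qubit_get (q : ι) (x : ι → Bool) : (qubit q).get x = x q := rfl

theorem qubit_set (q : ι) (x : ι → Bool) (e : Bool) :
    (qubit q).set x e = Function.update x q e := rfl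

/-- A pair of distinct qubits. -/
def qubitPair (p q : ι) (hpq : p ≠ q) : Subregister (ι → Bool) (Bool × Bool) where
  get x := (x p, x q)
  set x e := Function.update (Function.update x p e.1) q e.2
  get_set x e := by simp [Function.update_of_ne hpq]
  set_get x := by simp
  set_set x e e' := by
    ext i
    simp only [Function.update_apply]
    split_ifs <;> rfl

variable [Fintype ι]

theorem one_toOp (q : ι) (u : Matrix.unitaryGroup Bool ℂ) :
    (Gate.one q u).toOp = (qubit q).op fun _ => u.1 := by
  ext x y
  simp only [Gate.toOp, Subregister.op_apply, qubit, Function.eq_update_iff, true_and]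

theorem two_toOp {p q : ι} (hpq : p ≠ q) (u : Matrix.unitaryGroup (Bool × Bool) ℂ) :
    (Gate.two p q hpq u).toOp = (qubitPair p q hpq).op fun _ => u.1 := by
  ext x y
  have h : (∀ i, i ≠ p → i ≠ q → x i = y i) ↔
      x = Function.update (Function.update y p (x p)) q (x q) := by
    simp only [Function.eq_update_iff, true_and]
    refine forall_congr' fun i => ?_
    by_cases hi : i = p
    · simp [hi]
    · simp [hi]
  simp only [Gate.toOp, Subregister.op_apply, qubitPair, h]

theorem gate_toOp_mem_unitaryGroup (g : Gate ι) :
    g.toOp ∈ Matrix.unitaryGroup (ι → Bool) ℂ := by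
  cases g with
  | one q u =>
    rw [one_toOp]
    exact (qubit q).op_mem_unitaryGroup (fun _ _ => rfl) fun _ => u.2
  | two p q hpq u =>
    rw [two_toOp]
    exact (qubitPair p q hpq).op_mem_unitaryGroup (fun _ _ => rfl) fun _ => u.2

/-- The unitary on two qubits that applies `k x` to the second one if the first one is `x`. -/
def controlled (k : Bool → Matrix.unitaryGroup Bool ℂ) : Matrix.unitaryGroup (Bool × Bool) ℂ :=
  ⟨(sndSubregister Bool Bool).op fun e => (k e.1).1,
    Subregister.op_mem_unitaryGroup _ (fun _ _ => rfl) fun e => (k e.1).2⟩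

/-- The gate that applies `k x` to qubit `t` if qubit `p` is `x`. It is trivial if `p = t`. -/
def ctrl (p t : ι) (k : Bool → Matrix.unitaryGroup Bool ℂ) : Gate ι :=
  if h : p = t then .one t 1 else .two p t h (controlled k)

theorem ctrl_toOp {p t : ι} (hpt : p ≠ t) (k : Bool → Matrix.unitaryGroup Bool ℂ) :
    (ctrl p t k).toOp = (qubit t).op fun x => (k (x p)).1 := by
  ext x y
  have h : x = Function.update y t (x t) ↔
      (∀ i, i ≠ p → i ≠ t → x i = y i) ∧ x p = y p := by
    simp only [Function.eq_update_iff, true_and]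
    refine ⟨fun h => ⟨fun i _ => h i, h p hpt⟩, fun h i hi => ?_⟩
    by_cases hip : i = p
    · rw [hip, h.2]
    · exact h.1 i hip hi
  rw [ctrl, dif_neg hpt]
  simp only [Gate.toOp, controlled, Subregister.op_apply, sndSubregister, qubit, h, ite_and,
    Prod.mk.injEq, and_true]

end Subregisters

section OneQubit

/-- The amplitude `1 / √2`. -/
def sqrtHalf : ℝ := √2 / 2

theorem sqrtHalf_mul_self : (sqrtHalf : ℂ) * sqrtHalf = 1 / 2 := by
  rw [← Complex.ofReal_mul, sqrtHalf, div_mul_div_comm, Real.mul_self_sqrt two_pos.le]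
  norm_num

/-- The diagonal gate with signs `-1` on the basis states selected by `f`. -/
def signGate (f : Bool → Bool) : Matrix.unitaryGroup Bool ℂ :=
  ⟨Matrix.diagonal fun b => if f b then -1 else 1, by
    rw [Matrix.mem_unitaryGroup_iff, Matrix.star_eq_conjTranspose, Matrix.diagonal_conjTranspose,
      Matrix.diagonal_mul_diagonal, ← Matrix.diagonal_one]
    congr 1
    ext b
    cases h : f b <;> simp [h]⟩

/-- A gate with first column `(r, √(1 - r ^ 2))`. -/
def rotation (r : ℝ) (hr : |r| ≤ 1) : Matrix.unitaryGroup Bool ℂ :=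
  columnUnitary (fun i => if i then (√(1 - r ^ 2) : ℝ) else (r : ℝ)) (by
    have : r ^ 2 ≤ 1 := (sq_le_one_iff_abs_le_one r).2 hr
    simp [sq_abs, Real.sq_sqrt (sub_nonneg.2 this)])

/-- The Hadamard gate. -/
def hadamard : Matrix.unitaryGroup Bool ℂ :=
  ⟨Matrix.of fun i j => sqrtHalf * if i && j then -1 else 1, by
    rw [Matrix.mem_unitaryGroup_iff]
    ext i j
    cases i <;> cases j <;>
      norm_num [Matrix.mul_apply, Matrix.star_apply, sqrtHalf_mul_self]⟩

theorem hadamard_apply (i j : Bool) :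
    hadamard.1 i j = sqrtHalf * if i && j then -1 else 1 := rfl

theorem hadamard_mul_signGate_mul_hadamard : hadamard * signGate id * hadamard = bitFlip := by
  ext i j
  have h := sqrtHalf_mul_self
  cases i <;> cases j <;>
    norm_num [Matrix.mul_apply, hadamard_apply, signGate, bitFlip, h]

theorem hadamard_mul_self : hadamard * hadamard = 1 := by
  ext i j
  have h := sqrtHalf_mul_self
  cases i <;> cases j <;> norm_num [Matrix.mul_apply, hadamard_apply, h]

end OneQubit

section Joining

variable {b a s : ℕ}

/-- A further ancilla, as a qubit of the whole register. -/
abbrev ancWire (i : Fin b) : Wires b a s := Sum.inl (Sum.inl i)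

/-- The basis state with further ancillas in the state `f` and the other qubits in the
state `x`. -/
def join (f : Fin b → Bool) (x : Fin a ⊕ Fin s → Bool) : Wires b a s → Bool :=
  Sum.elim (Sum.elim f fun i => x (Sum.inl i)) fun i => x (Sum.inr i)

theorem join_ancWire (f : Fin b → Bool) (x : Fin a ⊕ Fin s → Bool) (i : Fin b) :
    join f x (ancWire i) = f i := rfl

theorem eq_join_iff {z : Wires b a s → Bool} {f : Fin b → Bool} {x : Fin a ⊕ Fin s → Bool} :
    z = join f x ↔ (∀ i, z (ancWire i) = f i) ∧ bePart z = x := by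
  constructor
  · rintro rfl
    refine ⟨fun i => rfl, ?_⟩
    ext (i | i) <;> rfl
  · rintro ⟨h, rfl⟩
    ext ((i | i) | i)
    · exact h i
    · rfl
    · rfl

theorem bePart_join (f : Fin b → Bool) (x : Fin a ⊕ Fin s → Bool) :
    bePart (join f x) = x := (eq_join_iff.1 rfl).2

theorem join_inj {f g : Fin b → Bool} {x y : Fin a ⊕ Fin s → Bool} :
    join f x = join g y ↔ f = g ∧ x = y := by
  rw [eq_join_iff, bePart_join]
  exact (funext_iff (f := f) (g := g)).symm.and Iff.rfl

theorem update_join (f : Fin b → Bool) (x : Fin a ⊕ Fin s → Bool) (t : Fin b) (v : Bool) :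
    Function.update (join f x) (ancWire t) v = join (Function.update f t v) x := by
  rw [eq_join_iff]
  refine ⟨fun i => ?_, ?_⟩
  · by_cases h : i = t
    · rw [h, Function.update_self, Function.update_self]
    · rw [Function.update_of_ne (by simpa using h), Function.update_of_ne h, join_ancWire]
  · ext (i | i) <;> rfl

/-- The register of the block-encoding. -/
def beRegister (b a s : ℕ) : Subregister (Wires b a s → Bool) (Fin a ⊕ Fin s → Bool) where
  get := bePart
  set z x := join (fun i => z (ancWire i)) x
  get_set _ _ := bePart_join _ _
  set_get _ := (eq_join_iff.2 ⟨fun _ => rfl, rfl⟩).symm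
  set_set _ _ _ := rfl

/-- The isometry that adds further ancillas in the state `f`. -/
def adjoin (a s : ℕ) (f : Fin b → Bool) : Matrix (Wires b a s → Bool) (Fin a ⊕ Fin s → Bool) ℂ :=
  embed (join f)

theorem conjTranspose_adjoin_mul_adjoin (f g : Fin b → Bool) :
    (adjoin a s f)ᴴ * adjoin a s g = if f = g then 1 else 0 := by
  rw [adjoin, adjoin, mul_embed]
  ext x y
  by_cases h : f = g <;>
  simp [Matrix.conjTranspose_apply, embed, join_inj, h, Matrix.one_apply, eq_comm,
    apply_ite (starRingEnd ℂ)]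

end Joining

section Steps

variable {b a s : ℕ}

theorem call_toOp (U : QOp (Fin a ⊕ Fin s)) (c : Fin b) (adj : Bool) :
    (Step.call c adj).toOp U =
      (beRegister b a s).op fun y => if y (ancWire c) then queryOp U adj else 1 := by
  ext x y
  have h : x = join (fun i => y (ancWire i)) (bePart x) ↔
      ∀ i : Fin b, x (ancWire i) = y (ancWire i) :=
    eq_join_iff.trans (and_iff_left rfl)
  simp only [Step.toOp, Subregister.op_apply, beRegister, h, queryOp]
  split_ifs <;> rfl

theorem call_mul_adjoin (U : QOp (Fin a ⊕ Fin s)) (c : Fin b) (adj : Bool) (f : Fin b → Bool) :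
    (Step.call c adj).toOp U * adjoin a s f =
      adjoin a s f * if f c then queryOp U adj else 1 := by
  rw [call_toOp]
  exact (beRegister b a s).op_mul_embed_set (fun _ _ => rfl) (join f fun _ => false)

/-- The adjoint of a step. -/
def Step.inv : Step b a s → Step b a s
  | .gate (.one q u) => .gate (.one q u⁻¹)
  | .gate (.two p q h u) => .gate (.two p q h u⁻¹)
  | .call c adj => .call c (!adj)

theorem step_toOp_inv (U : QOp (Fin a ⊕ Fin s)) (st : Step b a s) :
    st.inv.toOp U = (st.toOp U)ᴴ := by
  rcases st with (⟨q, u⟩ | ⟨p, q, hpq, u⟩) | ⟨c, adj⟩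
  · simp only [Step.inv, Step.toOp, one_toOp]
    exact ((qubit q).conjTranspose_op fun _ _ => rfl).symm
  · simp only [Step.inv, Step.toOp, two_toOp]
    exact ((qubitPair p q hpq).conjTranspose_op fun _ _ => rfl).symm
  · rw [Step.inv, call_toOp, call_toOp, (beRegister b a s).conjTranspose_op fun _ _ => rfl]
    congr 1
    ext1 y
    split_ifs
    · cases adj <;> simp [queryOp]
    · exact Matrix.conjTranspose_one.symm

theorem step_toOp_mem_unitaryGroup {U : QOp (Fin a ⊕ Fin s)}
    (hU : U ∈ Matrix.unitaryGroup (Fin a ⊕ Fin s → Bool) ℂ) (st : Step b a s) :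
    st.toOp U ∈ Matrix.unitaryGroup (Wires b a s → Bool) ℂ := by
  cases st with
  | gate g => exact gate_toOp_mem_unitaryGroup g
  | call c adj =>
    rw [call_toOp]
    refine (beRegister b a s).op_mem_unitaryGroup (fun _ _ => rfl) fun y => ?_
    split_ifs
    · cases adj
      · exact hU
      · exact Unitary.star_mem hU
    · exact one_mem _

theorem qubit_op_mul_adjoin {t : Fin b} {k : (Wires b a s → Bool) → Matrix Bool Bool ℂ}
    {f : Fin b → Bool} {M : Matrix Bool Bool ℂ} (hM : ∀ x, k (join f x) = M) :
    (qubit (ancWire t)).op k * adjoin a s f =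
      ∑ e, M e (f t) • adjoin a s (Function.update f t e) := by
  rw [adjoin, (qubit (ancWire t)).op_mul_embed hM fun x => join_ancWire f x t]
  simp only [qubit_set, update_join, adjoin]

theorem one_mul_adjoin (t : Fin b) (u : Matrix.unitaryGroup Bool ℂ) (f : Fin b → Bool) :
    (Gate.one (ancWire t) u : Gate (Wires b a s)).toOp * adjoin a s f =
      ∑ e, u.1 e (f t) • adjoin a s (Function.update f t e) := by
  rw [one_toOp, qubit_op_mul_adjoin fun _ => rfl]

theorem ctrl_mul_adjoin {p t : Fin b} (hpt : p ≠ t)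
    (k : Bool → Matrix.unitaryGroup Bool ℂ) (f : Fin b → Bool) :
    (ctrl (ancWire p) (ancWire t) k : Gate (Wires b a s)).toOp * adjoin a s f =
      ∑ e, (k (f p)).1 e (f t) • adjoin a s (Function.update f t e) := by
  rw [ctrl_toOp (by simpa using hpt), qubit_op_mul_adjoin (M := (k (f p)).1) fun _ => rfl]

theorem adjoin_mul_one (t : Fin b) (u : Matrix.unitaryGroup Bool ℂ) (f : Fin b → Bool) :
    (adjoin a s f)ᴴ * (Gate.one (ancWire t) u : Gate (Wires b a s)).toOp =
      ∑ e, u.1 (f t) e • (adjoin a s (Function.update f t e))ᴴ := by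
  have adjoint : (Gate.one (ancWire t) u⁻¹ : Gate (Wires b a s)).toOp =
      ((Gate.one (ancWire t) u : Gate (Wires b a s)).toOp)ᴴ :=
    step_toOp_inv (0 : QOp (Fin a ⊕ Fin s)) (.gate (.one (ancWire t) u))
  have h := congrArg Matrix.conjTranspose (one_mul_adjoin (a := a) (s := s) t u⁻¹ f)
  rw [Matrix.conjTranspose_mul, adjoint, Matrix.conjTranspose_conjTranspose,
    Matrix.conjTranspose_sum] at h
  rw [h]
  refine Finset.sum_congr rfl fun e _ => ?_
  rw [Matrix.conjTranspose_smul]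
  exact congrArg (· • _) (star_star (u.1 (f t) e))

theorem bitFlip_mul_adjoin (t : Fin b) (f : Fin b → Bool) :
    (Gate.one (ancWire t) bitFlip : Gate (Wires b a s)).toOp * adjoin a s f =
      adjoin a s (Function.update f t (!(f t))) := by
  simp [one_mul_adjoin, bitFlip]

theorem adjoin_mul_bitFlip (t : Fin b) (f : Fin b → Bool) :
    (adjoin a s f)ᴴ * (Gate.one (ancWire t) bitFlip : Gate (Wires b a s)).toOp =
      (adjoin a s (Function.update f t (!(f t))))ᴴ := by
  rw [adjoin_mul_one]
  cases f t <;> simp [bitFlip]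

end Steps

section Programs

variable {b a s : ℕ}

theorem toOp_append (U : QOp (Fin a ⊕ Fin s)) (P Q : Program b a s) :
    Program.toOp U (P ++ Q) = Program.toOp U Q * Program.toOp U P := by
  induction P with
  | nil => simp [Program.toOp]
  | cons st P ih => rw [List.cons_append, Program.toOp, ih, Matrix.mul_assoc, Program.toOp]

theorem toOp_singleton (U : QOp (Fin a ⊕ Fin s)) (st : Step b a s) :
    Program.toOp U [st] = st.toOp U := Matrix.one_mul _

theorem toOp_mem_unitaryGroup {U : QOp (Fin a ⊕ Fin s)}
    (hU : U ∈ Matrix.unitaryGroup (Fin a ⊕ Fin s → Bool) ℂ) (P : Program b a s) :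
    Program.toOp U P ∈ Matrix.unitaryGroup (Wires b a s → Bool) ℂ := by
  induction P with
  | nil => exact one_mem _
  | cons st P ih => exact mul_mem ih (step_toOp_mem_unitaryGroup hU st)

theorem calls_append (P Q : Program b a s) :
    Program.calls (P ++ Q) = Program.calls P + Program.calls Q := by
  induction P with
  | nil => simp [Program.calls]
  | cons st P ih => cases st <;> simp only [List.cons_append, Program.calls, ih, Nat.add_right_comm]

theorem otherGates_append (P Q : Program b a s) :
    Program.otherGates (P ++ Q) = Program.otherGates P + Program.otherGates Q := by
  induction P with
  | nil => simp [Program.otherGates]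
  | cons st P ih =>
    cases st <;> simp only [List.cons_append, Program.otherGates, ih, Nat.add_right_comm]

/-- The adjoint of a simulation circuit. -/
def Program.inv : Program b a s → Program b a s
  | [] => []
  | st :: P => Program.inv P ++ [st.inv]

theorem toOp_inv (U : QOp (Fin a ⊕ Fin s)) (P : Program b a s) :
    Program.toOp U (Program.inv P) = (Program.toOp U P)ᴴ := by
  induction P with
  | nil => simp [Program.inv, Program.toOp]
  | cons st P ih =>
    rw [Program.inv, toOp_append, ih, toOp_singleton, step_toOp_inv, Program.toOp,
      Matrix.conjTranspose_mul]

theorem calls_inv (P : Program b a s) : Program.calls (Program.inv P) = Program.calls P := by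
  induction P with
  | nil => rfl
  | cons st P ih =>
    rw [Program.inv, calls_append, ih]
    rcases st with (_ | _) | _ <;> rfl

theorem otherGates_inv (P : Program b a s) :
    Program.otherGates (Program.inv P) = Program.otherGates P := by
  induction P with
  | nil => rfl
  | cons st P ih =>
    rw [Program.inv, otherGates_append, ih]
    rcases st with (_ | _) | _ <;> rfl

end Programs

section Ladder

variable {b a s : ℕ}

/-- Computes the conjunction of qubit `p` and the negation of qubit `q` into the clean qubit `t`. If
`t` is not clean, a phase depends on it: an exact Toffoli gate would take more than three gates. -/
def andNot (p q t : Wires b a s) : Program b a s :=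
  [.gate (ctrl p t fun v => if v then hadamard else 1),
   .gate (ctrl q t fun v => if v then 1 else signGate id),
   .gate (ctrl p t fun v => if v then hadamard else 1)]

theorem andNot_toOp {p q t : Wires b a s} (hp : p ≠ t) (hq : q ≠ t) (U : QOp (Fin a ⊕ Fin s)) :
    Program.toOp U (andNot p q t) = (qubit t).op fun y =>
      (if y q then 1 else if y p then bitFlip else signGate id : Matrix.unitaryGroup Bool ℂ).1 := by
  simp only [andNot, Program.toOp, Step.toOp, Matrix.one_mul, ctrl_toOp hp, ctrl_toOp hq]
  rw [(qubit t).op_mul_op fun x e => by rw [qubit_set, Function.update_of_ne hp],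
    (qubit t).op_mul_op fun x e => by
      rw [qubit_set, Function.update_of_ne hp, Function.update_of_ne hq]]
  congr 1
  ext1 y
  rw [← Submonoid.coe_mul, ← Submonoid.coe_mul]
  cases y p <;> cases y q <;> simp [hadamard_mul_signGate_mul_hadamard, hadamard_mul_self]

theorem andNot_mul_embed {p q t : Wires b a s} (hp : p ≠ t) (hq : q ≠ t)
    (U : QOp (Fin a ⊕ Fin s)) {Z : Type} (g : Z → Wires b a s → Bool) (hg : ∀ z, g z t = false) :
    Program.toOp U (andNot p q t) * embed g =
      embed fun z => Function.update (g z) t (g z p && !(g z q)) := by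
  rw [andNot_toOp hp hq]
  refine (qubit t).op_mul_embed_of_classical fun z e => ?_
  rw [qubit_get, hg]
  cases g z p <;> cases g z q <;> cases e <;> simp [bitFlip, signGate]

/-- Computes the conjunction of qubit `p` and the negations of the qubits `q`, for the pairs
`(q, t)` of the list, into the last of the clean qubits `t`. -/
def ladder (p : Wires b a s) : List (Wires b a s × Wires b a s) → Program b a s
  | [] => []
  | (q, t) :: L => andNot p q t ++ ladder t L

/-- The qubit that holds the result of `ladder p L`. -/
def ladderFlag (p : Wires b a s) : List (Wires b a s × Wires b a s) → Wires b a s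
  | [] => p
  | (_, t) :: L => ladderFlag t L

/-- The action of `ladder p L` on basis states. -/
def ladderEval (p : Wires b a s) :
    List (Wires b a s × Wires b a s) → (Wires b a s → Bool) → Wires b a s → Bool
  | [], y => y
  | (q, t) :: L, y => ladderEval t L (Function.update y t (y p && !(y q)))

/-- The targets of the ladder are distinct, and different from its controls. -/
structure LadderOK (p : Wires b a s) (L : List (Wires b a s × Wires b a s)) : Prop where
  nodup : (L.map Prod.snd).Nodup
  head : p ∉ L.map Prod.snd
  control : ∀ e ∈ L, e.1 ∉ L.map Prod.snd

theorem LadderOK.tail {p q t : Wires b a s} {L : List (Wires b a s × Wires b a s)}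
    (h : LadderOK p ((q, t) :: L)) : LadderOK t L where
  nodup := (List.nodup_cons.1 h.nodup).2
  head := (List.nodup_cons.1 h.nodup).1
  control e he := fun h' => h.control e (List.mem_cons_of_mem _ he) (List.mem_cons_of_mem _ h')

theorem LadderOK.head_ne {p q t : Wires b a s} {L : List (Wires b a s × Wires b a s)}
    (h : LadderOK p ((q, t) :: L)) : p ≠ t :=
  fun h' => h.head (h' ▸ List.mem_cons_self)

theorem LadderOK.control_ne {p q t : Wires b a s} {L : List (Wires b a s × Wires b a s)}
    (h : LadderOK p ((q, t) :: L)) {e : Wires b a s × Wires b a s} (he : e ∈ (q, t) :: L) :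
    e.1 ≠ t :=
  fun h' => h.control e he (h' ▸ List.mem_cons_self)

theorem ladder_mul_embed (U : QOp (Fin a ⊕ Fin s)) {Z : Type}
    (L : List (Wires b a s × Wires b a s)) :
    ∀ (p : Wires b a s) (g : Z → Wires b a s → Bool), LadderOK p L →
      (∀ z, ∀ e ∈ L, g z e.2 = false) →
      Program.toOp U (ladder p L) * embed g = embed fun z => ladderEval p L (g z) := by
  induction L with
  | nil => intro p g _ _; simp [ladder, Program.toOp, ladderEval]
  | cons e L ih =>
    obtain ⟨q, t⟩ := e
    intro p g hL hg
    have clean := fun z => hg z (q, t) List.mem_cons_self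
    rw [ladder, toOp_append, Matrix.mul_assoc,
      andNot_mul_embed hL.head_ne (hL.control_ne List.mem_cons_self) U g clean]
    refine ih t _ hL.tail fun z e he => ?_
    have target_ne : e.2 ≠ t := fun h => hL.tail.head (h ▸ List.mem_map_of_mem he)
    rw [Function.update_of_ne target_ne]
    exact hg z e (List.mem_cons_of_mem _ he)

theorem ladderEval_of_notMem (L : List (Wires b a s × Wires b a s)) :
    ∀ (p : Wires b a s) (y : Wires b a s → Bool) (i : Wires b a s), i ∉ L.map Prod.snd →
      ladderEval p L y i = y i := by
  induction L with
  | nil => intros; rfl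
  | cons e L ih =>
    intro p y i hi
    rw [List.map_cons, List.mem_cons, not_or] at hi
    rw [ladderEval, ih _ _ _ hi.2, Function.update_of_ne hi.1]

theorem ladderEval_flag (L : List (Wires b a s × Wires b a s)) :
    ∀ (p : Wires b a s) (y : Wires b a s → Bool), LadderOK p L →
      ladderEval p L y (ladderFlag p L) = (y p && L.all fun e => !(y e.1)) := by
  induction L with
  | nil => intros; simp [ladderEval, ladderFlag]
  | cons e L ih =>
    obtain ⟨q, t⟩ := e
    intro p y hL
    rw [ladderEval, ladderFlag, ih _ _ hL.tail, Function.update_self, List.all_cons, Bool.and_assoc]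
    congr 2
    rw [Bool.eq_iff_iff, List.all_eq_true, List.all_eq_true]
    exact forall_congr' fun e => forall_congr' fun he => by
      rw [Function.update_of_ne (hL.control_ne (List.mem_cons_of_mem _ he))]

theorem ladderFlag_mem (L : List (Wires b a s × Wires b a s)) :
    ∀ p : Wires b a s, ladderFlag p L = p ∨ ladderFlag p L ∈ L.map Prod.snd := by
  induction L with
  | nil => intro p; exact Or.inl rfl
  | cons e L ih =>
    intro p
    rw [ladderFlag, List.map_cons, List.mem_cons]
    exact Or.inr (ih _)

/-- Flips the sign depending on qubit `t` and the conjunction computed by `ladder p L`. -/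
def flagSign (p : Wires b a s) (L : List (Wires b a s × Wires b a s)) (t : Wires b a s)
    (f : Bool → Bool → Bool) : Program b a s :=
  ladder p L ++ [.gate (ctrl (ladderFlag p L) t fun v => signGate (f v))] ++
    Program.inv (ladder p L)

theorem ctrl_signGate_toOp {p t : Wires b a s} (hpt : p ≠ t) (f : Bool → Bool → Bool) :
    (ctrl p t fun v => signGate (f v)).toOp =
      Matrix.diagonal fun y => if f (y p) (y t) then (-1 : ℂ) else 1 := by
  rw [ctrl_toOp hpt]
  exact (qubit t).op_diagonal fun y v => if f (y p) v then (-1 : ℂ) else 1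

theorem flagSign_mul_embed {U : QOp (Fin a ⊕ Fin s)}
    (hU : U ∈ Matrix.unitaryGroup (Fin a ⊕ Fin s → Bool) ℂ) {p t : Wires b a s}
    {L : List (Wires b a s × Wires b a s)} (hL : LadderOK p L) (htp : t ≠ p)
    (ht : t ∉ L.map Prod.snd) (f : Bool → Bool → Bool) {Z : Type} [Fintype Z] [DecidableEq Z]
    (g : Z → Wires b a s → Bool) (hg : ∀ z, ∀ e ∈ L, g z e.2 = false) :
    Program.toOp U (flagSign p L t f) * embed g = embed g * Matrix.diagonal fun z =>
      if f (g z p && L.all fun e => !(g z e.1)) (g z t) then (-1 : ℂ) else 1 := by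
  have flag_ne : ladderFlag p L ≠ t := by
    rcases ladderFlag_mem L p with h | h
    · rw [h]; exact htp.symm
    · exact fun h' => ht (h' ▸ h)
  have sign := diagonal_mul_embed (fun y => if f (y (ladderFlag p L)) (y t) then (-1 : ℂ) else 1)
    fun z => ladderEval p L (g z)
  simp only [ladderEval_flag L p _ hL, ladderEval_of_notMem L p _ t ht] at sign
  have uncompute : (Program.toOp U (ladder p L))ᴴ * Program.toOp U (ladder p L) = 1 :=
    Matrix.mem_unitaryGroup_iff'.1 (toOp_mem_unitaryGroup hU _)
  rw [flagSign, toOp_append, toOp_append, toOp_singleton, toOp_inv, Step.toOp,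
    ctrl_signGate_toOp flag_ne, Matrix.mul_assoc, Matrix.mul_assoc, ladder_mul_embed U L p g hL hg,
    sign, ← ladder_mul_embed U L p g hL hg, ← Matrix.mul_assoc, ← Matrix.mul_assoc, uncompute,
    Matrix.one_mul]

theorem calls_ladder (L : List (Wires b a s × Wires b a s)) :
    ∀ p, Program.calls (ladder p L) = 0 := by
  induction L with
  | nil => intro p; rfl
  | cons e L ih => intro p; rw [ladder, calls_append, ih]; rfl

theorem otherGates_ladder (L : List (Wires b a s × Wires b a s)) :
    ∀ p, Program.otherGates (ladder p L) = 3 * L.length := by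
  induction L with
  | nil => intro p; rfl
  | cons e L ih =>
    intro p
    rw [ladder, otherGates_append, ih, List.length_cons]
    simp only [andNot, Program.otherGates]
    omega

theorem calls_flagSign (p : Wires b a s) (L : List (Wires b a s × Wires b a s))
    (t : Wires b a s) (f : Bool → Bool → Bool) : Program.calls (flagSign p L t f) = 0 := by
  rw [flagSign, calls_append, calls_append, calls_inv, calls_ladder]; rfl

theorem otherGates_flagSign (p : Wires b a s) (L : List (Wires b a s × Wires b a s))
    (t : Wires b a s) (f : Bool → Bool → Bool) :
    Program.otherGates (flagSign p L t f) = 6 * L.length + 1 := by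
  rw [flagSign, otherGates_append, otherGates_append, otherGates_inv, otherGates_ladder]
  simp only [Program.otherGates]
  omega

end Ladder

section ZeroBlock

variable {κ σ : Type}

theorem eq_sumElim_false_iff {x : κ ⊕ σ → Bool} {z : σ → Bool} :
    x = Sum.elim (fun _ => false) z ↔
      (∀ i, x (Sum.inl i) = false) ∧ z = fun i => x (Sum.inr i) := by
  simp only [funext_iff, Sum.forall, Sum.elim_inl, Sum.elim_inr, eq_comm]

variable [Fintype κ] [DecidableEq κ] [Fintype σ] [DecidableEq σ]

/-- The isometry that adds ancillas in the state `0`. -/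
def zeroEmb (κ σ : Type) [Fintype κ] [DecidableEq κ] [Fintype σ] [DecidableEq σ] :
    Matrix (κ ⊕ σ → Bool) (σ → Bool) ℂ :=
  embed fun x => Sum.elim (fun _ => false) x

theorem zeroEmb_isometry : (zeroEmb κ σ)ᴴ * zeroEmb κ σ = 1 :=
  embed_isometry fun _ _ h => funext fun i => congrFun h (Sum.inr i)

theorem zeroBlock_eq (U : QOp (κ ⊕ σ)) : zeroBlock U = (zeroEmb κ σ)ᴴ * (U * zeroEmb κ σ) := by
  rw [zeroEmb, conjTranspose_embed_mul, mul_embed]; rfl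

theorem zeroEmb_mul_conjTranspose : zeroEmb κ σ * (zeroEmb κ σ)ᴴ =
    Matrix.diagonal fun x => if ∀ i, x (Sum.inl i) = false then 1 else 0 := by
  ext x y
  simp only [Matrix.mul_apply, zeroEmb, embed, Matrix.conjTranspose_apply, Matrix.diagonal_apply,
    eq_sumElim_false_iff]
  by_cases hx : ∀ i, x (Sum.inl i) = false
  · have same : ((∀ i, y (Sum.inl i) = false) ∧ (fun i => y (Sum.inr i)) = fun i => x (Sum.inr i)) ↔
        x = y := by
      rw [eq_comm (a := x), eq_comm (a := fun i => y (Sum.inr i)), ← eq_sumElim_false_iff,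
        ← (eq_sumElim_false_iff.2 ⟨hx, rfl⟩ : x = _)]
    simp [hx, ite_and, ← same, apply_ite (starRingEnd ℂ)]
  · simp [hx]

theorem reflection_zeroEmb : reflection (zeroEmb κ σ) =
    Matrix.diagonal fun x => if ∀ i, x (Sum.inl i) = false then 1 else -1 := by
  rw [reflection, zeroEmb_mul_conjTranspose, ← Matrix.diagonal_one, ← Matrix.diagonal_smul,
    Matrix.diagonal_sub]
  congr 1
  ext x
  by_cases hx : ∀ i, x (Sum.inl i) = false
  · norm_num [hx]
  · simp [hx]

theorem zeroBlock_wires {b a s : ℕ} (W : QOp (Wires b a s)) :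
    zeroBlock W = (zeroEmb (Fin a) (Fin s))ᴴ *
      (((adjoin a s fun _ : Fin b => false)ᴴ * (W * adjoin a s fun _ : Fin b => false)) *
        zeroEmb (Fin a) (Fin s)) := by
  have factor : zeroEmb (Fin b ⊕ Fin a) (Fin s) =
      adjoin a s (fun _ : Fin b => false) * zeroEmb (Fin a) (Fin s) := by
    rw [adjoin, zeroEmb, zeroEmb, embed_mul_embed]
    congr 1
    ext x i
    rcases i with (i | i) | i <;> rfl
  rw [zeroBlock_eq, factor, Matrix.conjTranspose_mul]
  simp only [Matrix.mul_assoc]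

end ZeroBlock

section Layout

variable {a s : ℕ}

/-- The number of further ancillas. -/
abbrev numAnc (a : ℕ) : ℕ := a + 2 + 3

/-- The qubits on which conjunctions are computed. -/
def workQ (i : Fin (a + 2)) : Fin (numAnc a) := Fin.castAdd 3 i

/-- The further ancillas that are not work qubits: the signal processing qubit `0`, the selection
qubit `1`, and the control `2` of idle uses of the block-encoding, which is always `|0⟩`. -/
def extraQ (i : Fin 3) : Fin (numAnc a) := Fin.natAdd (a + 2) i

theorem workQ_inj {i j : Fin (a + 2)} : workQ i = workQ j ↔ i = j :=
  (Fin.castAdd_injective (a + 2) 3).eq_iff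

theorem extraQ_inj {i j : Fin 3} : (extraQ i : Fin (numAnc a)) = extraQ j ↔ i = j :=
  (Fin.natAdd_injective 3 (a + 2)).eq_iff

theorem workQ_ne_extraQ (i : Fin (a + 2)) (j : Fin 3) : workQ i ≠ extraQ j := by
  simp only [workQ, extraQ, Ne, Fin.ext_iff, Fin.val_castAdd, Fin.val_natAdd]
  lia

theorem extraQ_one_ne_zero : (extraQ 1 : Fin (numAnc a)) ≠ extraQ 0 := by
  rw [Ne, extraQ_inj]; decide

theorem update_append_extraQ (u : Fin (a + 2) → Bool) (f : Fin 3 → Bool) (i : Fin 3) (v : Bool) :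
    Function.update (Fin.append u f) (extraQ i) v = Fin.append u (Function.update f i v) := by
  ext j
  refine Fin.addCases (fun j => ?_) (fun j => ?_) j
  · exact (Function.update_of_ne (workQ_ne_extraQ j i) _ _).trans
      ((Fin.append_left _ _ _).trans (Fin.append_left _ _ _).symm)
  · rw [Fin.append_right, extraQ, Function.update_apply, Fin.append_right, Function.update_apply]
    simp only [Fin.natAdd_inj]

/-- The state of the further ancillas during the simulation: the first work qubit is `1`, the
other work qubits are `0`, the signal processing qubit is `c` and the selection qubit is `l`. -/
def ancState (a : ℕ) (l c : Bool) : Fin (numAnc a) → Bool :=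
  Fin.append (fun i : Fin (a + 2) => decide (i = 0)) ![c, l, false]

theorem ancState_work (l c : Bool) (i : Fin (a + 2)) :
    ancState a l c (workQ i) = decide (i = 0) := Fin.append_left _ _ _

theorem ancState_extra (l c : Bool) (i : Fin 3) :
    ancState a l c (extraQ i) = ![c, l, false] i := Fin.append_right _ _ _

theorem update_ancState_zero (l c v : Bool) :
    Function.update (ancState a l c) (extraQ 0) v = ancState a l v := by
  rw [ancState, update_append_extraQ, ancState]
  congr 1
  ext i
  fin_cases i <;> rfl

theorem update_ancState_one (l c v : Bool) :
    Function.update (ancState a l c) (extraQ 1) v = ancState a v c := by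
  rw [ancState, update_append_extraQ, ancState]
  congr 1
  ext i
  fin_cases i <;> rfl

theorem ancState_inj {l c l' c' : Bool} :
    ancState a l c = ancState a l' c' ↔ l = l' ∧ c = c' := by
  refine ⟨fun h => ?_, fun h => by rw [h.1, h.2]⟩
  have signal := congrFun h (extraQ 0)
  have selection := congrFun h (extraQ 1)
  rw [ancState_extra, ancState_extra] at signal selection
  exact ⟨selection, signal⟩

theorem update_zero_work :
    Function.update (fun _ => false) (workQ 0) true = ancState a false false := by
  ext j
  refine Fin.addCases (fun j => ?_) (fun j => ?_) j
  · refine Eq.trans ?_ (ancState_work false false j).symm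
    by_cases h : j = 0
    · rw [h]; simp [workQ]
    · exact (Function.update_of_ne (workQ_inj.not.2 h) true fun _ => false).trans
        (decide_eq_false h).symm
  · refine (Function.update_of_ne (workQ_ne_extraQ 0 j).symm _ _).trans ?_
    refine Eq.trans ?_ (ancState_extra false false j).symm
    fin_cases j <;> rfl

/-- The pairs of the ladder that tests if the ancillas of the block-encoding are all `0`. -/
def beLadder (a s : ℕ) : List (Wires (numAnc a) a s × Wires (numAnc a) a s) :=
  (List.finRange a).map fun i => (Sum.inl (Sum.inr i), ancWire (workQ i.succ.castSucc))

/-- The pairs of the ladder that also tests if the signal processing qubit is `0`. -/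
def fullLadder (a s : ℕ) : List (Wires (numAnc a) a s × Wires (numAnc a) a s) :=
  beLadder a s ++ [(ancWire (extraQ 0), ancWire (workQ (Fin.last (a + 1))))]

theorem mem_fullLadder {e : Wires (numAnc a) a s × Wires (numAnc a) a s} :
    e ∈ fullLadder a s ↔
      (∃ i : Fin a, (Sum.inl (Sum.inr i), ancWire (workQ i.succ.castSucc)) = e) ∨
        e = (ancWire (extraQ 0), ancWire (workQ (Fin.last (a + 1)))) := by
  simp [fullLadder, beLadder]

theorem map_snd_fullLadder : (fullLadder a s).map Prod.snd =
    (List.finRange (a + 1)).map fun i : Fin (a + 1) => ancWire (workQ i.succ) := by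
  rw [fullLadder, beLadder, List.finRange_succ_last]
  simp [Function.comp_def]

theorem ancWire_mem_fullLadder {j : Fin (numAnc a)} :
    (ancWire j : Wires (numAnc a) a s) ∈ (fullLadder a s).map Prod.snd ↔
      ∃ i : Fin (a + 1), workQ i.succ = j := by
  simp [map_snd_fullLadder]

theorem extraQ_notMem_fullLadder (i : Fin 3) :
    (ancWire (extraQ i) : Wires (numAnc a) a s) ∉ (fullLadder a s).map Prod.snd := by
  rw [ancWire_mem_fullLadder]
  exact fun ⟨j, h⟩ => workQ_ne_extraQ _ _ h

theorem fullLadder_ok : LadderOK (ancWire (workQ 0)) (fullLadder a s) where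
  nodup := by
    rw [map_snd_fullLadder]
    refine (List.nodup_finRange (a + 1)).map fun i j h => ?_
    simpa [workQ_inj] using h
  head := by
    rw [ancWire_mem_fullLadder]
    exact fun ⟨i, h⟩ => i.succ_ne_zero (workQ_inj.1 h)
  control e he := by
    rcases mem_fullLadder.1 he with ⟨i, rfl⟩ | rfl
    · simp [map_snd_fullLadder]
    · exact extraQ_notMem_fullLadder 0

theorem LadderOK.of_append {b : ℕ} {p : Wires b a s} {L L' : List (Wires b a s × Wires b a s)}
    (h : LadderOK p (L ++ L')) : LadderOK p L := by
  obtain ⟨nodup, head, control⟩ := h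
  rw [List.map_append] at nodup head control
  exact ⟨nodup.of_append_left, fun h => head (List.mem_append_left _ h),
    fun e he h => control e (List.mem_append_left _ he) (List.mem_append_left _ h)⟩

theorem join_fullLadder (l c : Bool) (x : Fin a ⊕ Fin s → Bool)
    {e : Wires (numAnc a) a s × Wires (numAnc a) a s} (he : e ∈ fullLadder a s) :
    join (ancState a l c) x e.2 = false := by
  have target : e.2 ∈ (fullLadder a s).map Prod.snd := List.mem_map_of_mem he
  rw [map_snd_fullLadder] at target
  obtain ⟨i, -, h⟩ := List.mem_map.1 target
  rw [← h, join_ancWire, ancState_work, decide_eq_false i.succ_ne_zero]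

theorem beLadder_all (l c : Bool) (x : Fin a ⊕ Fin s → Bool) :
    ((beLadder a s).all fun e => !(join (ancState a l c) x e.1)) =
      decide (∀ i, x (Sum.inl i) = false) := by
  rw [Bool.eq_iff_iff]
  simp [beLadder, join]

/-- The reflection about the zero state of the ancillas of the block-encoding, controlled by the
state `v` of the signal processing qubit. -/
def signalReflection (a s : ℕ) (v : Bool) : Program (numAnc a) a s :=
  flagSign (ancWire (workQ 0)) (beLadder a s) (ancWire (extraQ 0)) fun w c => !w && (c == v)

/-- The reflection about the zero state of all ancillas. -/
def fullReflection (a s : ℕ) : Program (numAnc a) a s :=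
  flagSign (ancWire (workQ 0)) (fullLadder a s) (ancWire (extraQ 1)) fun w l => !(w && !l)

theorem ancWire_extraQ_ne_workQ (i : Fin 3) (j : Fin (a + 2)) :
    (ancWire (extraQ i) : Wires (numAnc a) a s) ≠ ancWire (workQ j) := by
  simpa using (workQ_ne_extraQ j i).symm

theorem signalReflection_mul {U : QOp (Fin a ⊕ Fin s)}
    (hU : U ∈ Matrix.unitaryGroup (Fin a ⊕ Fin s → Bool) ℂ) (v l c : Bool) :
    Program.toOp U (signalReflection a s v) * adjoin a s (ancState a l c) =
      adjoin a s (ancState a l c) *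
        if c = v then reflection (zeroEmb (Fin a) (Fin s)) else 1 := by
  rw [adjoin, signalReflection, flagSign_mul_embed hU fullLadder_ok.of_append
    (ancWire_extraQ_ne_workQ 0 0)
    (fun h => extraQ_notMem_fullLadder 0 (by
      rw [fullLadder, List.map_append]; exact List.mem_append_left _ h)) _ _
    (fun x e he => join_fullLadder l c x (List.mem_append_left _ he))]
  congr 1
  simp only [join_ancWire, ancState_work, ancState_extra, beLadder_all, reflection_zeroEmb,
    ← Matrix.diagonal_one]
  split_ifs with h
  all_goals
    congr 1
    ext x
    by_cases hx : ∀ i, x (Sum.inl i) = false <;> simp [h, hx]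

theorem fullReflection_mul {U : QOp (Fin a ⊕ Fin s)}
    (hU : U ∈ Matrix.unitaryGroup (Fin a ⊕ Fin s → Bool) ℂ) (l c : Bool) :
    Program.toOp U (fullReflection a s) * adjoin a s (ancState a l c) =
      adjoin a s (ancState a l c) *
        if l = false ∧ c = false then reflection (zeroEmb (Fin a) (Fin s)) else -1 := by
  rw [adjoin, fullReflection, flagSign_mul_embed hU fullLadder_ok (ancWire_extraQ_ne_workQ 1 0)
    (extraQ_notMem_fullLadder 1) _ _ (fun x e he => join_fullLadder l c x he)]
  congr 1
  simp only [fullLadder, List.all_append, List.all_cons, List.all_nil, join_ancWire, ancState_work,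
    ancState_extra, beLadder_all, reflection_zeroEmb]
  split_ifs with h
  · congr 1
    ext x
    by_cases hx : ∀ i, x (Sum.inl i) = false <;> simp [h, hx]
  · rw [← Matrix.diagonal_one, Matrix.diagonal_neg]
    congr 1
    ext x
    cases l <;> cases c <;> simp_all

end Layout

section SignalOp

variable {m n : Type} [Fintype m] [DecidableEq m] [Fintype n]
variable {J : Matrix m n ℂ} {U : Matrix m m ℂ}

/-- The operator that quantum signal processing with `d` uses of `U` and the phase gates `A` applies
to the register of `U` when it takes the signal processing qubit from `0` to `c`. -/
def signalOp (J : Matrix m n ℂ) (U : Matrix m m ℂ) (A : ℕ → Matrix.unitaryGroup Bool ℂ) (d : ℕ)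
    (c : Bool) : Matrix m m ℂ :=
  word J U d * Polynomial.aeval (walkSq J U) (signalPoly A d c)

theorem signalOp_zero (A : ℕ → Matrix.unitaryGroup Bool ℂ) (c : Bool) :
    signalOp J U A 0 c = (A 0).1 c false • 1 := by
  rw [signalOp, word, signalPoly, Polynomial.aeval_C, Matrix.one_mul,
    Algebra.algebraMap_eq_smul_one]

theorem signalOp_succ [DecidableEq n] (hJ : Jᴴ * J = 1) (hU : U ∈ Matrix.unitaryGroup m ℂ)
    (A : ℕ → Matrix.unitaryGroup Bool ℂ) (d : ℕ) (e : Bool) :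
    signalOp J U A (d + 1) e = ∑ c, (A (d + 1)).1 e c •
      ((if c = true then reflection J else 1) * (queryOp U d.bodd *
        ((if c = false then reflection J else 1) * signalOp J U A d c))) := by
  have walk (c : Bool) : (if c = true then reflection J else 1) * (queryOp U d.bodd *
      ((if c = false then reflection J else 1) * word J U d)) =
        word J U (d + 1) * walkSq J U ^ c.toNat := by
    cases c
    · simp [word]
    · simp [reflection_queryOp_word hJ hU]
  simp only [signalOp, signalPoly, Matrix.mulVec, dotProduct, Matrix.map_apply, map_sum, map_mul,
    map_pow, Polynomial.aeval_C, Polynomial.aeval_X, ← Algebra.smul_def, Matrix.mul_sum,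
    Matrix.mul_smul]
  refine Finset.sum_congr rfl fun c _ => ?_
  rw [← Matrix.mul_assoc, ← walk]
  simp only [Matrix.mul_assoc]

end SignalOp

section SignalProcessing

variable {a s : ℕ}

/-- One step of quantum signal processing: a use of the block-encoding, controlled by `ctl`, and a
gate on the signal processing qubit that is controlled by the selection qubit. -/
def signalStep (a s : ℕ) (ctl : Fin (numAnc a)) (adj : Bool)
    (k : Bool → Matrix.unitaryGroup Bool ℂ) : Program (numAnc a) a s :=
  signalReflection a s false ++ [.call ctl adj] ++ signalReflection a s true ++
    [.gate (ctrl (ancWire (extraQ 1)) (ancWire (extraQ 0)) k)]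

theorem ctrl_mul_adjoin_ancState (k : Bool → Matrix.unitaryGroup Bool ℂ) (l c : Bool) :
    (ctrl (ancWire (extraQ 1)) (ancWire (extraQ 0)) k : Gate (Wires (numAnc a) a s)).toOp *
      adjoin a s (ancState a l c) = ∑ e, (k l).1 e c • adjoin a s (ancState a l e) := by
  simp [ctrl_mul_adjoin extraQ_one_ne_zero, update_ancState_zero, ancState_extra]

theorem hadamard_mul_adjoin_ancState (l c : Bool) :
    (Gate.one (ancWire (extraQ 1)) hadamard : Gate (Wires (numAnc a) a s)).toOp *
      adjoin a s (ancState a l c) = ∑ e, hadamard.1 e l • adjoin a s (ancState a e c) := by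
  simp [one_mul_adjoin, update_ancState_one, ancState_extra]

theorem adjoin_ancState_mul_hadamard (l c : Bool) :
    (adjoin a s (ancState a l c))ᴴ *
      (Gate.one (ancWire (extraQ 1)) hadamard : Gate (Wires (numAnc a) a s)).toOp =
        ∑ e, hadamard.1 l e • (adjoin a s (ancState a e c))ᴴ := by
  simp [adjoin_mul_one, update_ancState_one, ancState_extra]

theorem signalStep_mul {U : QOp (Fin a ⊕ Fin s)}
    (hU : U ∈ Matrix.unitaryGroup (Fin a ⊕ Fin s → Bool) ℂ) (ctl : Fin (numAnc a)) (adj : Bool)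
    (k : Bool → Matrix.unitaryGroup Bool ℂ) (l c : Bool) :
    Program.toOp U (signalStep a s ctl adj k) * adjoin a s (ancState a l c) =
      ∑ e, (k l).1 e c • (adjoin a s (ancState a l e) *
        ((if c = true then reflection (zeroEmb (Fin a) (Fin s)) else 1) *
          ((if ancState a l c ctl = true then queryOp U adj else 1) *
            (if c = false then reflection (zeroEmb (Fin a) (Fin s)) else 1)))) := by
  simp only [signalStep, toOp_append, toOp_singleton, Matrix.mul_assoc]
  rw [signalReflection_mul hU, ← Matrix.mul_assoc ((Step.call ctl adj).toOp U), call_mul_adjoin,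
    Matrix.mul_assoc, ← Matrix.mul_assoc (Program.toOp U _), signalReflection_mul hU,
    Matrix.mul_assoc, Step.toOp, ← Matrix.mul_assoc _ (adjoin a s _), ctrl_mul_adjoin_ancState]
  simp only [Matrix.sum_mul, Matrix.smul_mul]

/-- Quantum signal processing with `n` uses of the block-encoding, for the phase gates `k`. -/
def signalCore (a s : ℕ) (k : ℕ → Bool → Matrix.unitaryGroup Bool ℂ) : ℕ → Program (numAnc a) a s
  | 0 => [.gate (ctrl (ancWire (extraQ 1)) (ancWire (extraQ 0)) (k 0))]
  | n + 1 => signalCore a s k n ++ signalStep a s (workQ 0) n.bodd (k (n + 1))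

variable {U : QOp (Fin a ⊕ Fin s)}

theorem signalStep_mul_sum (hU : U ∈ Matrix.unitaryGroup (Fin a ⊕ Fin s → Bool) ℂ)
    {ctl : Fin (numAnc a)} {l : Bool} (hctl : ∀ c, ancState a l c ctl = true)
    (k : ℕ → Bool → Matrix.unitaryGroup Bool ℂ) (n : ℕ) :
    Program.toOp U (signalStep a s ctl n.bodd (k (n + 1))) *
        (∑ c, adjoin a s (ancState a l c) * signalOp (zeroEmb _ _) U (fun i => k i l) n c) =
      ∑ e, adjoin a s (ancState a l e) *
        signalOp (zeroEmb _ _) U (fun i => k i l) (n + 1) e := by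
  simp only [signalOp_succ zeroEmb_isometry hU, Matrix.mul_sum]
  rw [Finset.sum_comm]
  refine Finset.sum_congr rfl fun c _ => ?_
  rw [← Matrix.mul_assoc, signalStep_mul hU, hctl, if_pos rfl, Matrix.sum_mul]
  simp only [Matrix.smul_mul, Matrix.mul_smul, Matrix.mul_assoc]

theorem signalCore_mul (hU : U ∈ Matrix.unitaryGroup (Fin a ⊕ Fin s → Bool) ℂ)
    (k : ℕ → Bool → Matrix.unitaryGroup Bool ℂ) (l : Bool) (n : ℕ) :
    Program.toOp U (signalCore a s k n) * adjoin a s (ancState a l false) =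
      ∑ e, adjoin a s (ancState a l e) *
        signalOp (zeroEmb _ _) U (fun i => k i l) n e := by
  induction n with
  | zero =>
    simp only [signalCore, toOp_singleton, Step.toOp, ctrl_mul_adjoin_ancState, signalOp_zero,
      Matrix.mul_smul, Matrix.mul_one]
  | succ n ih =>
    rw [signalCore, toOp_append, Matrix.mul_assoc, ih,
      signalStep_mul_sum hU (fun c => ancState_work l c 0)]

theorem signalStep_mul_of_idle (hU : U ∈ Matrix.unitaryGroup (Fin a ⊕ Fin s → Bool) ℂ)
    {ctl : Fin (numAnc a)} {l c : Bool} (hctl : ancState a l c ctl = false) (adj : Bool)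
    {k : Bool → Matrix.unitaryGroup Bool ℂ} (hk : k l = 1) :
    Program.toOp U (signalStep a s ctl adj k) * adjoin a s (ancState a l c) =
      adjoin a s (ancState a l c) * reflection (zeroEmb (Fin a) (Fin s)) := by
  rw [signalStep_mul hU, hk, hctl, Fintype.sum_bool]
  cases c <;> simp

/-- The linear combination of an even polynomial, with `n` uses of the block-encoding, and an odd
polynomial, with `n + 1` uses. -/
def evolutionCore (a s : ℕ) (k : ℕ → Bool → Matrix.unitaryGroup Bool ℂ) (n : ℕ) :
    Program (numAnc a) a s :=
  [.gate (.one (ancWire (extraQ 1)) hadamard)] ++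
    (signalCore a s k n ++ signalStep a s (extraQ 1) n.bodd (k (n + 1))) ++
    [.gate (.one (ancWire (extraQ 1)) hadamard)]

theorem conjTranspose_adjoin_mul_sum (l l' c : Bool) (B : Bool → QOp (Fin a ⊕ Fin s)) :
    (adjoin a s (ancState a l' c))ᴴ * ∑ e, adjoin a s (ancState a l e) * B e =
      if l' = l then B c else 0 := by
  simp only [Matrix.mul_sum, ← Matrix.mul_assoc, conjTranspose_adjoin_mul_adjoin, ancState_inj]
  by_cases h : l' = l <;> simp [h]

theorem block_signalCore_step (hU : U ∈ Matrix.unitaryGroup (Fin a ⊕ Fin s → Bool) ℂ)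
    {k : ℕ → Bool → Matrix.unitaryGroup Bool ℂ} {n : ℕ} (hk : k (n + 1) false = 1) (l l' : Bool) :
    (zeroEmb (Fin a) (Fin s))ᴴ * ((adjoin a s (ancState a l' false))ᴴ *
      (Program.toOp U (signalCore a s k n ++ signalStep a s (extraQ 1) n.bodd (k (n + 1))) *
        adjoin a s (ancState a l false))) =
      if l' = l then (zeroEmb (Fin a) (Fin s))ᴴ *
        signalOp (zeroEmb _ _) U (fun i => k i l) (n + l.toNat) false else 0 := by
  rw [toOp_append, Matrix.mul_assoc, signalCore_mul hU]
  cases l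
  · rw [Matrix.mul_sum]
    simp only [← Matrix.mul_assoc (Program.toOp U _),
      signalStep_mul_of_idle hU (ancState_extra false _ 1) _ hk]
    simp only [Matrix.mul_assoc]
    rw [conjTranspose_adjoin_mul_sum]
    split_ifs
    · rw [← Matrix.mul_assoc, conjTranspose_mul_reflection zeroEmb_isometry]
      rfl
    · rw [Matrix.mul_zero]
  · rw [signalStep_mul_sum hU (fun c => ancState_extra true c 1), conjTranspose_adjoin_mul_sum]
    split_ifs
    · rfl
    · rw [Matrix.mul_zero]

theorem block_evolutionCore (hU : U ∈ Matrix.unitaryGroup (Fin a ⊕ Fin s → Bool) ℂ)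
    {k : ℕ → Bool → Matrix.unitaryGroup Bool ℂ} {n : ℕ} (hk : k (n + 1) false = 1) :
    (zeroEmb (Fin a) (Fin s))ᴴ * ((adjoin a s (ancState a false false))ᴴ *
      (Program.toOp U (evolutionCore a s k n) * adjoin a s (ancState a false false))) =
      (1 / 2 : ℂ) • ∑ l : Bool, (zeroEmb (Fin a) (Fin s))ᴴ *
        signalOp (zeroEmb _ _) U (fun i => k i l) (n + l.toNat) false := by
  have hadamard_column (l : Bool) : hadamard.1 l false * hadamard.1 false l = 1 / 2 := by
    cases l <;> simpa [hadamard_apply] using sqrtHalf_mul_self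
  rw [evolutionCore, toOp_append, toOp_append, toOp_singleton, Step.toOp, Matrix.mul_assoc,
    Matrix.mul_assoc, hadamard_mul_adjoin_ancState, ← Matrix.mul_assoc (adjoin a s _)ᴴ,
    adjoin_ancState_mul_hadamard]
  simp only [Matrix.mul_sum, Matrix.sum_mul, Matrix.smul_mul, Matrix.mul_smul,
    block_signalCore_step hU hk, Finset.smul_sum]
  simp only [smul_ite, smul_zero, Finset.sum_ite_eq', Finset.mem_univ, if_true, smul_smul,
    hadamard_column]

end SignalProcessing

section CleanAncillas

variable {a s : ℕ} {U : QOp (Fin a ⊕ Fin s)}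

/-- The projection onto the states in which all ancillas that stay clean are clean. -/
def cleanProj (a s : ℕ) : QOp (Wires (numAnc a) a s) :=
  ∑ l, ∑ c, adjoin a s (ancState a l c) * (adjoin a s (ancState a l c))ᴴ

theorem cleanProj_mul_adjoin (l c : Bool) :
    cleanProj a s * adjoin a s (ancState a l c) = adjoin a s (ancState a l c) := by
  simp only [cleanProj, Matrix.sum_mul, Matrix.mul_assoc, conjTranspose_adjoin_mul_adjoin,
    ancState_inj]
  cases l <;> cases c <;> simp

theorem conjTranspose_cleanProj : (cleanProj a s)ᴴ = cleanProj a s := by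
  simp [cleanProj, Matrix.conjTranspose_mul]

theorem cleanProj_mul_of_column {A : QOp (Wires (numAnc a) a s)}
    (h : ∀ l c, cleanProj a s * (A * adjoin a s (ancState a l c)) =
      A * adjoin a s (ancState a l c)) :
    cleanProj a s * (A * cleanProj a s) = A * cleanProj a s := by
  simp only [← Matrix.mul_assoc] at h
  conv_lhs => enter [2, 2]; rw [cleanProj]
  conv_rhs => rw [cleanProj]
  simp only [Matrix.mul_sum, ← Matrix.mul_assoc, h]

theorem cleanProj_mul_self : cleanProj a s * cleanProj a s = cleanProj a s := by
  simpa only [Matrix.one_mul] using cleanProj_mul_of_column (A := 1) fun l c => by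
    rw [Matrix.one_mul, cleanProj_mul_adjoin]

/-- The simulation circuit keeps the ancillas clean that are clean in the range of `cleanProj`. -/
def PreservesClean (U : QOp (Fin a ⊕ Fin s)) (P : Program (numAnc a) a s) : Prop :=
  cleanProj a s * (Program.toOp U P * cleanProj a s) = Program.toOp U P * cleanProj a s

theorem PreservesClean.append {P Q : Program (numAnc a) a s} (hP : PreservesClean U P)
    (hQ : PreservesClean U Q) : PreservesClean U (P ++ Q) := by
  unfold PreservesClean at *
  have factor : Program.toOp U Q * (Program.toOp U P * cleanProj a s) =
        cleanProj a s *
          (Program.toOp U Q * (cleanProj a s * (Program.toOp U P * cleanProj a s))) := by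
    rw [← Matrix.mul_assoc _ (cleanProj a s), ← Matrix.mul_assoc (cleanProj a s), hQ,
      Matrix.mul_assoc, hP]
  rw [toOp_append, Matrix.mul_assoc, factor, ← Matrix.mul_assoc (cleanProj a s) (cleanProj a s),
    cleanProj_mul_self]

theorem preservesClean_hadamard (U : QOp (Fin a ⊕ Fin s)) :
    PreservesClean U [.gate (.one (ancWire (extraQ 1)) hadamard)] := by
  refine cleanProj_mul_of_column fun l c => ?_
  rw [toOp_singleton, Step.toOp, hadamard_mul_adjoin_ancState]
  simp only [Matrix.mul_sum, Matrix.mul_smul, cleanProj_mul_adjoin]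

theorem preservesClean_ctrl (U : QOp (Fin a ⊕ Fin s)) (k : Bool → Matrix.unitaryGroup Bool ℂ) :
    PreservesClean U [.gate (ctrl (ancWire (extraQ 1)) (ancWire (extraQ 0)) k)] := by
  refine cleanProj_mul_of_column fun l c => ?_
  rw [toOp_singleton, Step.toOp, ctrl_mul_adjoin_ancState]
  simp only [Matrix.mul_sum, Matrix.mul_smul, cleanProj_mul_adjoin]

theorem preservesClean_signalStep (hU : U ∈ Matrix.unitaryGroup (Fin a ⊕ Fin s → Bool) ℂ)
    (ctl : Fin (numAnc a)) (adj : Bool) (k : Bool → Matrix.unitaryGroup Bool ℂ) :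
    PreservesClean U (signalStep a s ctl adj k) := by
  refine cleanProj_mul_of_column fun l c => ?_
  rw [signalStep_mul hU]
  simp only [Matrix.mul_sum, Matrix.mul_smul, ← Matrix.mul_assoc, cleanProj_mul_adjoin]

theorem preservesClean_signalCore (hU : U ∈ Matrix.unitaryGroup (Fin a ⊕ Fin s → Bool) ℂ)
    (k : ℕ → Bool → Matrix.unitaryGroup Bool ℂ) (n : ℕ) :
    PreservesClean U (signalCore a s k n) := by
  induction n with
  | zero => exact preservesClean_ctrl U (k 0)
  | succ n ih => exact ih.append (preservesClean_signalStep hU _ _ _)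

theorem preservesClean_evolutionCore (hU : U ∈ Matrix.unitaryGroup (Fin a ⊕ Fin s → Bool) ℂ)
    (k : ℕ → Bool → Matrix.unitaryGroup Bool ℂ) (n : ℕ) :
    PreservesClean U (evolutionCore a s k n) :=
  ((preservesClean_hadamard U).append
    ((preservesClean_signalCore hU k n).append (preservesClean_signalStep hU _ _ _))).append
    (preservesClean_hadamard U)

end CleanAncillas

section Amplification

variable {m n : Type} [Fintype m] [DecidableEq m] [Fintype n] [DecidableEq n]
variable {W F Q : Matrix m m ℂ} {J : Matrix m n ℂ}

open scoped ComplexOrder in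
theorem commute_of_mul_mul_eq (hW : W ∈ Matrix.unitaryGroup m ℂ) (hQ : Qᴴ = Q)
    (hQQ : Q * Q = Q) (h : Q * (W * Q) = W * Q) : Q * W = W * Q := by
  have adjoint : Q * (Wᴴ * Q) = Q * Wᴴ := by
    have := congrArg Matrix.conjTranspose h
    simpa only [Matrix.conjTranspose_mul, hQ, Matrix.mul_assoc] using this
  have expand : (Q * W - W * Q) * (Q * W - W * Q)ᴴ = Q - W * (Q * Wᴴ) := by
    have cross : Q * (W * (Q * Wᴴ)) = W * (Q * Wᴴ) := by
      rw [← Matrix.mul_assoc W, ← Matrix.mul_assoc Q, h]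
    have unit : Q * (W * (Wᴴ * Q)) = Q := by
      rw [← Matrix.mul_assoc W, ← Matrix.star_eq_conjTranspose, Matrix.mem_unitaryGroup_iff.1 hW,
        Matrix.one_mul, hQQ]
    simp only [Matrix.conjTranspose_sub, Matrix.conjTranspose_mul, hQ, Matrix.mul_sub,
      Matrix.sub_mul, Matrix.mul_assoc]
    rw [unit, cross, adjoint, ← Matrix.mul_assoc Q Q, hQQ]
    abel
  refine sub_eq_zero.1 (Matrix.trace_mul_conjTranspose_self_eq_zero_iff.1 ?_)
  rw [expand, Matrix.trace_sub, Matrix.trace_mul_comm, Matrix.mul_assoc,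
    ← Matrix.star_eq_conjTranspose, Matrix.mem_unitaryGroup_iff'.1 hW, Matrix.mul_one, sub_self]

omit [DecidableEq n] in
theorem reflection_mul {l : Type} (A : Matrix m l ℂ) :
    reflection J * A = (2 : ℂ) • (J * (Jᴴ * A)) - A := by
  rw [reflection, Matrix.sub_mul, Matrix.smul_mul, Matrix.one_mul, Matrix.mul_assoc]

theorem block_amplification_reflection (hW : W ∈ Matrix.unitaryGroup m ℂ) (hJ : Jᴴ * J = 1)
    {B : Matrix n n ℂ} (hB : Jᴴ * (W * J) = B) :
    Jᴴ * (W * (reflection J * (Wᴴ * (reflection J * (W * J))))) =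
      (4 : ℂ) • (B * Bᴴ * B) - (3 : ℂ) • B := by
  have cancel (A : Matrix m n ℂ) : Wᴴ * (W * A) = A := by
    rw [← Matrix.mul_assoc, ← Matrix.star_eq_conjTranspose, Matrix.mem_unitaryGroup_iff'.1 hW,
      Matrix.one_mul]
  have cancel' (A : Matrix m n ℂ) : W * (Wᴴ * A) = A := by
    rw [← Matrix.mul_assoc, ← Matrix.star_eq_conjTranspose, Matrix.mem_unitaryGroup_iff.1 hW,
      Matrix.one_mul]
  have isometry (A : Matrix n n ℂ) : Jᴴ * (J * A) = A := by
    rw [← Matrix.mul_assoc, hJ, Matrix.one_mul]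
  have block (A : Matrix n n ℂ) : Jᴴ * (W * (J * A)) = B * A := by
    rw [← Matrix.mul_assoc W, ← Matrix.mul_assoc, hB]
  have block' (A : Matrix n n ℂ) : Jᴴ * (Wᴴ * (J * A)) = Bᴴ * A := by
    rw [← hB, Matrix.conjTranspose_mul, Matrix.conjTranspose_mul,
      Matrix.conjTranspose_conjTranspose]
    simp only [Matrix.mul_assoc]
  simp only [reflection_mul, Matrix.mul_sub, Matrix.mul_smul, cancel, cancel', isometry, block,
    block', hB, hJ, Matrix.mul_one, Matrix.mul_assoc]
  module

theorem block_amplification (hW : W ∈ Matrix.unitaryGroup m ℂ) (hJ : Jᴴ * J = 1) (hQ : Qᴴ = Q)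
    (hQJ : Q * J = J) (hQW : Q * W = W * Q) (hF : F * Q = reflection J * Q) {B : Matrix n n ℂ}
    (hB : Jᴴ * (W * J) = B) :
    Jᴴ * (W * (F * (Wᴴ * (F * (W * J))))) = (4 : ℂ) • (B * Bᴴ * B) - (3 : ℂ) • B := by
  have on_range {A : Matrix m n ℂ} (hA : Q * A = A) : F * A = reflection J * A := by
    rw [← hA, ← Matrix.mul_assoc, hF, Matrix.mul_assoc]
  have hQW' : Q * Wᴴ = Wᴴ * Q := by
    simpa only [Matrix.conjTranspose_mul, hQ] using (congrArg Matrix.conjTranspose hQW).symm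
  have hQWJ : Q * (W * J) = W * J := by rw [← Matrix.mul_assoc, hQW, Matrix.mul_assoc, hQJ]
  have hQRWJ : Q * (reflection J * (W * J)) = reflection J * (W * J) := by
    rw [reflection_mul, Matrix.mul_sub, Matrix.mul_smul, ← Matrix.mul_assoc Q J, hQJ, hQWJ]
  rw [on_range hQWJ, on_range, block_amplification_reflection hW hJ hB]
  rw [← Matrix.mul_assoc, hQW', Matrix.mul_assoc, hQRWJ]

end Amplification

section Norms

theorem norm_le_one_of_isometry {m n : Type} [Fintype m] [Fintype n] [DecidableEq n]
    [Nonempty n] {J : Matrix m n ℂ} (hJ : Jᴴ * J = 1) : ‖J‖ ≤ 1 := by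
  classical
  have norm_sq_eq := Matrix.l2_opNorm_conjTranspose_mul_self J
  rw [hJ, CStarRing.norm_one] at norm_sq_eq
  exact le_of_sq_le_sq (by linarith) zero_le_one

variable {κ σ : Type} [Fintype κ] [DecidableEq κ] [Fintype σ] [DecidableEq σ]
variable {A : QOp σ} {U : QOp (κ ⊕ σ)}

theorem norm_zeroBlock_le_one (hU : U ∈ Matrix.unitaryGroup (κ ⊕ σ → Bool) ℂ) :
    ‖zeroBlock U‖ ≤ 1 := by
  have hJ := norm_le_one_of_isometry (zeroEmb_isometry (κ := κ) (σ := σ))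
  have hJ' : ‖(zeroEmb κ σ)ᴴ‖ ≤ 1 := by rwa [Matrix.l2_opNorm_conjTranspose]
  rw [zeroBlock_eq]
  refine (Matrix.l2_opNorm_mul _ _).trans (mul_le_one₀ hJ' (norm_nonneg _) ?_)
  exact (Matrix.l2_opNorm_mul _ _).trans
    (mul_le_one₀ (CStarRing.norm_of_mem_unitary hU).le (norm_nonneg _) hJ)

theorem IsBlockEncoding.norm_le {α ε : ℝ} (h : IsBlockEncoding α ε A U) : ‖A‖ ≤ ε + α := by
  calc ‖A‖ ≤ ‖A - (α : ℂ) • zeroBlock U‖ + ‖(α : ℂ) • zeroBlock U‖ := norm_le_norm_sub_add _ _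
    _ ≤ ε + α := by
      refine add_le_add h.error_le ?_
      rw [norm_smul, Complex.norm_real, Real.norm_of_nonneg h.alpha_nonneg]
      exact mul_le_of_le_one_right h.alpha_nonneg (norm_zeroBlock_le_one h.unitary)

theorem IsBlockEncoding.smul_zeroBlock_eq {α : ℝ} (h : IsBlockEncoding α 0 A U) :
    (α : ℂ) • zeroBlock U = A :=
  (sub_eq_zero.1 (norm_le_zero_iff.1 h.error_le)).symm

theorem IsBlockEncoding.smul_block_queryOp {α : ℝ} (h : IsBlockEncoding α 0 A U)
    (hA : A.IsHermitian) (b : Bool) :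
    (α : ℂ) • ((zeroEmb κ σ)ᴴ * (queryOp U b * zeroEmb κ σ)) = A := by
  have forward := h.smul_zeroBlock_eq
  rw [zeroBlock_eq] at forward
  cases b
  · exact forward
  · have backward := congrArg Matrix.conjTranspose forward
    rwa [hA.eq, Matrix.conjTranspose_smul, Matrix.conjTranspose_mul, Matrix.conjTranspose_mul,
      Matrix.conjTranspose_conjTranspose, Matrix.mul_assoc, Complex.star_def,
      Complex.conj_ofReal] at backward

theorem norm_smul_sub_le {E : Type*} [SeminormedAddCommGroup E] [NormedSpace ℂ E] {x y : E}
    {c δ : ℝ} (hx : ‖x‖ ≤ 1) (hxy : ‖x - y‖ ≤ δ) (hc : 0 ≤ c) (hc1 : c ≤ 1) :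
    ‖(c : ℂ) • y - x‖ ≤ c * δ + (1 - c) := by
  have split : (c : ℂ) • y - x = -((c : ℂ) • (x - y) + ((1 - c : ℝ) : ℂ) • x) := by
    push_cast
    module
  rw [split, norm_neg]
  refine (norm_add_le _ _).trans (add_le_add ?_ ?_)
  · rw [norm_smul, Complex.norm_real, Real.norm_of_nonneg hc]
    exact mul_le_mul_of_nonneg_left hxy hc
  · rw [norm_smul, Complex.norm_real, Real.norm_of_nonneg (sub_nonneg.2 hc1)]
    exact mul_le_of_le_one_right (sub_nonneg.2 hc1) hx

end Norms

section AmplificationError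

variable {n : Type} [Fintype n] [DecidableEq n] {E : Matrix n n ℂ}

theorem amplified_half_add_sub (hE : E ∈ Matrix.unitaryGroup n ℂ) (D : Matrix n n ℂ) :
    (3 : ℂ) • ((1 / 2 : ℂ) • (E + D)) -
        (4 : ℂ) • ((1 / 2 : ℂ) • (E + D) * ((1 / 2 : ℂ) • (E + D))ᴴ * ((1 / 2 : ℂ) • (E + D))) - E =
      (1 / 2 : ℂ) •
        (D - E * Dᴴ * E - (E * Dᴴ * D + D * Eᴴ * D + D * Dᴴ * E + D * Dᴴ * D)) := by
  have hEE : E * Eᴴ = 1 := Matrix.mem_unitaryGroup_iff.1 hE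
  have hDE : D * Eᴴ * E = D := by
    rw [Matrix.mul_assoc, ← Matrix.star_eq_conjTranspose, Matrix.mem_unitaryGroup_iff'.1 hE,
      Matrix.mul_one]
  have star_half : star (1 / 2 : ℂ) = 1 / 2 := by simp
  simp only [Matrix.conjTranspose_smul, Matrix.conjTranspose_add, star_half, Matrix.smul_mul,
    Matrix.mul_smul, Matrix.add_mul, Matrix.mul_add, hEE, hDE, Matrix.one_mul]
  module

theorem norm_mul_mul_le {X Y Z : Matrix n n ℂ} {x y z : ℝ} (hX : ‖X‖ ≤ x) (hY : ‖Y‖ ≤ y)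
    (hZ : ‖Z‖ ≤ z) : ‖X * Y * Z‖ ≤ x * y * z := by
  have hx : 0 ≤ x := (norm_nonneg X).trans hX
  have hy : 0 ≤ y := (norm_nonneg Y).trans hY
  exact (norm_mul_le _ _).trans (mul_le_mul ((norm_mul_le _ _).trans
    (mul_le_mul hX hY (norm_nonneg _) hx)) hZ (norm_nonneg _) (mul_nonneg hx hy))

-- At a unitary `E` the map `B ↦ 3 B - 4 B Bᴴ B` sends `E / 2` to `E`, and its derivative there is
-- `D ↦ D - E Dᴴ E`, so that an error `D` of `2 B` is not magnified to first order.
theorem norm_amplified_sub_le [Nonempty n] (hE : E ∈ Matrix.unitaryGroup n ℂ) {B : Matrix n n ℂ}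
    {η : ℝ} (hη : ‖(2 : ℂ) • B - E‖ ≤ η) :
    ‖(3 : ℂ) • B - (4 : ℂ) • (B * Bᴴ * B) - E‖ ≤ η + (3 * η ^ 2 + η ^ 3) / 2 := by
  obtain ⟨D, hD⟩ : ∃ D, D = (2 : ℂ) • B - E := ⟨_, rfl⟩
  rw [← hD] at hη
  have hB : B = (1 / 2 : ℂ) • (E + D) := by
    rw [hD]
    module
  have hE1 : ‖E‖ ≤ 1 := (CStarRing.norm_of_mem_unitary hE).le
  have hEstar : ‖Eᴴ‖ ≤ 1 := by rwa [Matrix.l2_opNorm_conjTranspose]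
  have hDstar : ‖Dᴴ‖ ≤ η := by rwa [Matrix.l2_opNorm_conjTranspose]
  have linear : ‖D - E * Dᴴ * E‖ ≤ η + 1 * η * 1 :=
    (norm_sub_le _ _).trans (add_le_add hη (norm_mul_mul_le hE1 hDstar hE1))
  have higher : ‖E * Dᴴ * D + D * Eᴴ * D + D * Dᴴ * E + D * Dᴴ * D‖ ≤
      1 * η * η + η * 1 * η + η * η * 1 + η * η * η :=
    norm_add_le_of_le (norm_add_le_of_le (norm_add_le_of_le (norm_mul_mul_le hE1 hDstar hη)
      (norm_mul_mul_le hη hEstar hη)) (norm_mul_mul_le hη hDstar hE1))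
      (norm_mul_mul_le hη hDstar hη)
  have norm_half : ‖(1 / 2 : ℂ)‖ = 1 / 2 := by norm_num
  rw [hB, amplified_half_add_sub hE, norm_smul, norm_half]
  linarith [norm_sub_le_of_le linear higher]

end AmplificationError

section Normalization

variable {E : Type*} [NormedAddCommGroup E] [NormedSpace ℂ E] {φ χ : E} {κ : ℝ}

omit [NormedSpace ℂ E] in
theorem one_sub_two_mul_le_norm_sq (hχ : ‖χ‖ = 1) (h : ‖φ - χ‖ ≤ κ) : 1 - 2 * κ ≤ ‖φ‖ ^ 2 := by
  have := norm_sub_norm_le χ φ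
  rw [norm_sub_rev] at this
  nlinarith [sq_nonneg (‖φ‖ - 1)]

theorem norm_inv_norm_smul_sub_le (hχ : ‖χ‖ = 1) (h : ‖φ - χ‖ ≤ κ) :
    ‖((‖φ‖⁻¹ : ℝ) : ℂ) • φ - χ‖ ≤ 2 * κ := by
  have normalize : ‖((‖φ‖⁻¹ : ℝ) : ℂ) • φ - φ‖ ≤ κ := by
    rcases eq_or_ne φ 0 with rfl | hφ
    · simpa using (norm_nonneg _).trans h
    · have factor : ((‖φ‖⁻¹ : ℝ) : ℂ) • φ - φ = ((‖φ‖⁻¹ - 1 : ℝ) : ℂ) • φ := by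
        push_cast
        module
      calc ‖((‖φ‖⁻¹ : ℝ) : ℂ) • φ - φ‖ = |‖χ‖ - ‖φ‖| := by
            rw [factor, norm_smul, Complex.norm_real, Real.norm_eq_abs, ← abs_norm φ, ← abs_mul,
              abs_norm, sub_mul, inv_mul_cancel₀ (norm_ne_zero_iff.2 hφ), one_mul, hχ]
        _ ≤ ‖χ - φ‖ := abs_norm_sub_norm_le _ _
        _ ≤ κ := by rwa [norm_sub_rev]
  linarith [norm_sub_le_norm_sub_add_norm_sub (((‖φ‖⁻¹ : ℝ) : ℂ) • φ) φ χ]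

end Normalization

section Precision

variable {τ ε : ℝ} {n : ℕ}

theorem div_two_mul_add_one_le_half (hε : 0 < ε) (hε1 : ε ≤ 1)
    (h : 2.8 * τ + Real.log (1 / ε) ≤ n) : τ / (2 * n + 1 : ℕ) ≤ 1 / 2 := by
  have log_nonneg : 0 ≤ Real.log (1 / ε) := Real.log_nonneg ((one_le_div hε).2 hε1)
  rw [div_le_iff₀ (by positivity)]
  push_cast
  linarith

theorem exists_phases (hτ : 0 ≤ τ) (hε : 0 < ε) (hε1 : ε ≤ 1) (hn : 1 ≤ n)
    (h : 2.8 * τ + Real.log (1 / ε) ≤ n) :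
    ∃ k : ℕ → Bool → Matrix.unitaryGroup Bool ℂ, k (2 * (n - 1) + 1) false = 1 ∧
      ∀ l : Bool, signalPoly (fun i => k i l) (2 * (n - 1) + l.toNat) false =
        expPoly ((1 / (1 + ε / 6) : ℝ) : ℂ) τ n l.toNat := by
  have contraction : 1 / (1 + ε / 6) * (1 + ε / 7) < 1 := by
    rw [one_div_mul_eq_div, div_lt_one (by positivity)]
    linarith
  choose A hA using fun l : Bool => exists_signalPoly
    (natDegree_expPoly_le ((1 / (1 + ε / 6) : ℝ) : ℂ) τ n l.toNat)
    (norm_eval_expPoly_lt hn hτ (div_two_mul_add_one_le_half hε hε1 h)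
      (taylor_remainder_le hτ hε hε1 hn h) (by positivity) contraction l)
  refine ⟨fun i l => if l = false ∧ i = 2 * (n - 1) + 1 then 1 else A l i, by simp, fun l => ?_⟩
  rw [← hA l]
  refine congrFun (signalPoly_congr fun i hi => if_neg ?_) false
  rintro ⟨rfl, rfl⟩
  simp at hi

theorem norm_smul_taylorEvolution_sub_le {s : ℕ} {H : QOp (Fin s)} (hH : H.IsHermitian) {α t : ℝ}
    (hα : ‖H‖ ≤ α) (ht : 0 ≤ t) (hε : 0 < ε) (hε1 : ε ≤ 1) (hn : 1 ≤ n)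
    (h : 2.8 * (α * t) + Real.log (1 / ε) ≤ n) :
    ‖((1 / (1 + ε / 6) : ℝ) : ℂ) • taylorEvolution H t n - evolution H t‖ ≤ 13 / 42 * ε := by
  have hτ : 0 ≤ α * t := mul_nonneg ((norm_nonneg H).trans hα) ht
  have taylor_close : ‖evolution H t - taylorEvolution H t n‖ ≤ ε / 7 :=
    (norm_evolution_sub_taylor_le hα ht hn (div_two_mul_add_one_le_half hε hε1 h)).trans
      (taylor_remainder_le hτ hε hε1 hn h)
  have scale_le_one : 1 / (1 + ε / 6) ≤ 1 := by
    rw [div_le_one (by positivity)]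
    linarith
  have one_sub_scale_le : 1 - 1 / (1 + ε / 6) ≤ ε / 6 := by
    rw [sub_le_iff_le_add, ← sub_le_iff_le_add', le_div_iff₀ (by positivity)]
    nlinarith
  have close := norm_smul_sub_le (c := 1 / (1 + ε / 6))
    (CStarRing.norm_of_mem_unitary (evolution_mem_unitaryGroup hH t)).le
    taylor_close (by positivity) scale_le_one
  linarith [mul_le_mul_of_nonneg_right scale_le_one (by positivity : 0 ≤ ε / 7)]

end Precision

section ScaledProgram

variable {a s : ℕ} {U : QOp (Fin a ⊕ Fin s)}

/-- The embedding of the signal register with all ancillas `0`, except the first work qubit, which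
is the constant control of the uses of the block-encoding. -/
def startEmb (a s : ℕ) : Matrix (Wires (numAnc a) a s → Bool) (Fin s → Bool) ℂ :=
  adjoin a s (ancState a false false) * zeroEmb (Fin a) (Fin s)

theorem startEmb_isometry : (startEmb a s)ᴴ * startEmb a s = 1 := by
  rw [startEmb, Matrix.conjTranspose_mul, Matrix.mul_assoc, ← Matrix.mul_assoc (adjoin a s _)ᴴ,
    conjTranspose_adjoin_mul_adjoin, if_pos rfl, Matrix.one_mul, zeroEmb_isometry]

theorem cleanProj_mul_startEmb : cleanProj a s * startEmb a s = startEmb a s := by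
  rw [startEmb, ← Matrix.mul_assoc, cleanProj_mul_adjoin]

theorem PreservesClean.mul_adjoin {P : Program (numAnc a) a s} (hP : PreservesClean U P)
    (l c : Bool) : cleanProj a s * (Program.toOp U P * adjoin a s (ancState a l c)) =
      Program.toOp U P * adjoin a s (ancState a l c) := by
  have := congrArg (· * adjoin a s (ancState a l c)) hP
  simpa only [Matrix.mul_assoc, cleanProj_mul_adjoin] using this

theorem conjTranspose_adjoin_mul_cleanProj {f : Fin (numAnc a) → Bool} (hf : f (extraQ 2) = true) :
    (adjoin a s f)ᴴ * cleanProj a s = 0 := by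
  simp only [cleanProj, Matrix.mul_sum, ← Matrix.mul_assoc, conjTranspose_adjoin_mul_adjoin]
  refine Finset.sum_eq_zero fun l _ => Finset.sum_eq_zero fun c _ => ?_
  rw [if_neg, Matrix.zero_mul]
  rintro rfl
  simp [ancState_extra] at hf

/-- The circuit `P`, with the first work qubit set to `1` while it runs, followed by a gate `u` on
an ancilla that `P` keeps clean, which scales the encoded block by an entry of `u`. -/
def scaledProgram (u : Matrix.unitaryGroup Bool ℂ) (P : Program (numAnc a) a s) :
    Program (numAnc a) a s :=
  [.gate (.one (ancWire (workQ 0)) bitFlip)] ++ P ++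
    ([.gate (.one (ancWire (workQ 0)) bitFlip)] ++ [.gate (.one (ancWire (extraQ 2)) u)])

theorem bitFlip_mul_adjoin_zero :
    (Gate.one (ancWire (workQ 0)) bitFlip : Gate (Wires (numAnc a) a s)).toOp *
      (adjoin a s fun _ : Fin (numAnc a) => false) = adjoin a s (ancState a false false) := by
  rw [bitFlip_mul_adjoin, Bool.not_false, update_zero_work]

theorem adjoin_zero_mul_scale (u : Matrix.unitaryGroup Bool ℂ) :
    (adjoin a s fun _ : Fin (numAnc a) => false)ᴴ *
      ((Gate.one (ancWire (extraQ 2)) u : Gate (Wires (numAnc a) a s)).toOp *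
        ((Gate.one (ancWire (workQ 0)) bitFlip : Gate (Wires (numAnc a) a s)).toOp *
          cleanProj a s)) =
      u.1 false false • ((adjoin a s (ancState a false false))ᴴ * cleanProj a s) := by
  have flag_zero : Function.update (fun _ : Fin (numAnc a) => false) (extraQ 2) false =
      fun _ => false := Function.update_eq_self (extraQ 2) _
  rw [← Matrix.mul_assoc, adjoin_mul_one, Fintype.sum_bool, flag_zero, Matrix.add_mul,
    Matrix.smul_mul, Matrix.smul_mul, ← Matrix.mul_assoc (adjoin a s _)ᴴ,
    ← Matrix.mul_assoc (adjoin a s _)ᴴ, adjoin_mul_bitFlip, adjoin_mul_bitFlip, Bool.not_false,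
    update_zero_work, conjTranspose_adjoin_mul_cleanProj, smul_zero, zero_add]
  rw [Function.update_of_ne (workQ_ne_extraQ _ _).symm, Function.update_self]

theorem zeroBlock_scaledProgram (u : Matrix.unitaryGroup Bool ℂ) {P : Program (numAnc a) a s}
    (hP : PreservesClean U P) :
    zeroBlock (Program.toOp U (scaledProgram u P)) =
      u.1 false false • ((startEmb a s)ᴴ * (Program.toOp U P * startEmb a s)) := by
  have scale := congrArg (· * (Program.toOp U P * adjoin a s (ancState a false false)))
    (adjoin_zero_mul_scale (a := a) (s := s) u)
  simp only [Matrix.mul_assoc, Matrix.smul_mul, hP.mul_adjoin] at scale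
  rw [zeroBlock_wires, scaledProgram]
  simp only [toOp_append, toOp_singleton, Step.toOp, Matrix.mul_assoc]
  rw [← Matrix.mul_assoc _ (adjoin a s _) (zeroEmb _ _), bitFlip_mul_adjoin_zero]
  rw [startEmb, Matrix.conjTranspose_mul]
  have := congrArg (fun X => (zeroEmb (Fin a) (Fin s))ᴴ * (X * zeroEmb (Fin a) (Fin s))) scale
  simpa only [Matrix.mul_assoc, Matrix.smul_mul, Matrix.mul_smul] using this

end ScaledProgram

section AmplifiedProgram

variable {a s : ℕ} {U : QOp (Fin a ⊕ Fin s)}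

theorem PreservesClean.commute {P : Program (numAnc a) a s}
    (hU : U ∈ Matrix.unitaryGroup (Fin a ⊕ Fin s → Bool) ℂ) (hP : PreservesClean U P) :
    cleanProj a s * Program.toOp U P = Program.toOp U P * cleanProj a s :=
  commute_of_mul_mul_eq (toOp_mem_unitaryGroup hU P) conjTranspose_cleanProj cleanProj_mul_self hP

theorem PreservesClean.inv {P : Program (numAnc a) a s}
    (hU : U ∈ Matrix.unitaryGroup (Fin a ⊕ Fin s → Bool) ℂ) (hP : PreservesClean U P) :
    PreservesClean U P.inv := by
  have adjoint := congrArg Matrix.conjTranspose (hP.commute hU)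
  rw [Matrix.conjTranspose_mul, Matrix.conjTranspose_mul, conjTranspose_cleanProj] at adjoint
  rw [PreservesClean, toOp_inv, adjoint, ← Matrix.mul_assoc, cleanProj_mul_self]

theorem preservesClean_fullReflection (hU : U ∈ Matrix.unitaryGroup (Fin a ⊕ Fin s → Bool) ℂ) :
    PreservesClean U (fullReflection a s) :=
  cleanProj_mul_of_column fun l c => by
    rw [fullReflection_mul hU, ← Matrix.mul_assoc, cleanProj_mul_adjoin]

theorem fullReflection_mul_cleanProj (hU : U ∈ Matrix.unitaryGroup (Fin a ⊕ Fin s → Bool) ℂ) :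
    Program.toOp U (fullReflection a s) * cleanProj a s =
      reflection (startEmb a s) * cleanProj a s := by
  have column (l c : Bool) : Program.toOp U (fullReflection a s) * adjoin a s (ancState a l c) =
      reflection (startEmb a s) * adjoin a s (ancState a l c) := by
    rw [fullReflection_mul hU, reflection_mul, startEmb, Matrix.conjTranspose_mul]
    simp only [Matrix.mul_assoc, conjTranspose_adjoin_mul_adjoin, ancState_inj]
    cases l <;> cases c <;> simp [reflection, Matrix.mul_sub]
  simp only [cleanProj, Matrix.mul_sum, ← Matrix.mul_assoc, column]

/-- One round of oblivious amplitude amplification of the circuit `P`. -/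
def amplify (P : Program (numAnc a) a s) : Program (numAnc a) a s :=
  P ++ fullReflection a s ++ P.inv ++ fullReflection a s ++ P

theorem PreservesClean.amplify {P : Program (numAnc a) a s}
    (hU : U ∈ Matrix.unitaryGroup (Fin a ⊕ Fin s → Bool) ℂ) (hP : PreservesClean U P) :
    PreservesClean U (amplify P) :=
  have hR := preservesClean_fullReflection hU
  (((hP.append hR).append (hP.inv hU)).append hR).append hP

theorem block_amplify {P : Program (numAnc a) a s}
    (hU : U ∈ Matrix.unitaryGroup (Fin a ⊕ Fin s → Bool) ℂ) (hP : PreservesClean U P)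
    {B : QOp (Fin s)} (hB : (startEmb a s)ᴴ * (Program.toOp U P * startEmb a s) = B) :
    (startEmb a s)ᴴ * (Program.toOp U (amplify P) * startEmb a s) =
      (4 : ℂ) • (B * Bᴴ * B) - (3 : ℂ) • B := by
  rw [← block_amplification (toOp_mem_unitaryGroup hU P) startEmb_isometry conjTranspose_cleanProj
    cleanProj_mul_startEmb (hP.commute hU) (fullReflection_mul_cleanProj hU) hB]
  simp only [amplify, toOp_append, toOp_inv, Matrix.mul_assoc]

/-- Uses of the block-encoding that are never activated and only serve to make up their number. -/
def idleCalls (a s m : ℕ) : Program (numAnc a) a s := List.replicate m (.call (extraQ 2) false)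

theorem idleCalls_mul (U : QOp (Fin a ⊕ Fin s)) (m : ℕ) {f : Fin (numAnc a) → Bool}
    (hf : f (extraQ 2) = false) :
    Program.toOp U (idleCalls a s m) * adjoin a s f = adjoin a s f := by
  induction m with
  | zero => exact Matrix.one_mul _
  | succ m ih =>
    rw [idleCalls, List.replicate_succ, Program.toOp, Matrix.mul_assoc, call_mul_adjoin, hf,
      if_neg Bool.false_ne_true, Matrix.mul_one, ← idleCalls, ih]

theorem zeroBlock_idleCalls_append (U : QOp (Fin a ⊕ Fin s)) (m : ℕ)
    (P : Program (numAnc a) a s) :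
    zeroBlock (Program.toOp U (idleCalls a s m ++ P)) = zeroBlock (Program.toOp U P) := by
  rw [zeroBlock_wires, zeroBlock_wires, toOp_append, Matrix.mul_assoc (Program.toOp U P),
    idleCalls_mul U m rfl]

end AmplifiedProgram

section EvolutionBlock

variable {a s n : ℕ} {U : QOp (Fin a ⊕ Fin s)} {H : QOp (Fin s)} {α c t : ℝ}

theorem startEmb_block_evolutionCore (hBE : IsBlockEncoding α 0 H U) (hH : H.IsHermitian)
    {k : ℕ → Bool → Matrix.unitaryGroup Bool ℂ} (hk : k (2 * (n - 1) + 1) false = 1)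
    (hp : ∀ l : Bool, signalPoly (fun i => k i l) (2 * (n - 1) + l.toNat) false =
      expPoly (c : ℂ) ((α * t : ℝ) : ℂ) n l.toNat) :
    (startEmb a s)ᴴ * (Program.toOp U (evolutionCore a s k (2 * (n - 1))) * startEmb a s) =
      (1 / 2 : ℂ) • ((c : ℂ) • taylorEvolution H t n) := by
  have parity_block (l : Bool) := block_expPoly zeroEmb_isometry hBE.unitary
    (hBE.smul_block_queryOp hH) (c : ℂ) (t : ℂ) n l.toNat
  have block := block_evolutionCore hBE.unitary hk
  simp only [signalOp, hp, Complex.ofReal_mul, parity_block] at block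
  have := congrArg (· * zeroEmb (Fin a) (Fin s)) block
  rw [startEmb, Matrix.conjTranspose_mul]
  simp only [Matrix.mul_assoc] at this ⊢
  rw [this, Fintype.sum_bool]
  simp only [Matrix.smul_mul, Matrix.add_mul, Matrix.mul_assoc, zeroEmb_isometry, Matrix.mul_one]
  rw [taylorEvolution, sum_range_two_mul]
  simp only [Bool.toNat_true, Bool.toNat_false, add_zero]
  module

end EvolutionBlock

section Counting

variable {a s : ℕ}

theorem calls_signalStep (ctl : Fin (numAnc a)) (adj : Bool)
    (k : Bool → Matrix.unitaryGroup Bool ℂ) :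
    Program.calls (signalStep a s ctl adj k) = 1 := by
  simp only [signalStep, signalReflection, calls_append, calls_flagSign, Program.calls]

theorem otherGates_signalReflection (v : Bool) :
    Program.otherGates (signalReflection a s v) = 6 * a + 1 := by
  rw [signalReflection, otherGates_flagSign, beLadder, List.length_map, List.length_finRange]

theorem otherGates_fullReflection : Program.otherGates (fullReflection a s) = 6 * a + 7 := by
  rw [fullReflection, otherGates_flagSign, fullLadder, beLadder, List.length_append,
    List.length_map, List.length_finRange, List.length_singleton]
  ring

theorem otherGates_signalStep (ctl : Fin (numAnc a)) (adj : Bool)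
    (k : Bool → Matrix.unitaryGroup Bool ℂ) :
    Program.otherGates (signalStep a s ctl adj k) = 12 * a + 3 := by
  simp only [signalStep, otherGates_append, otherGates_signalReflection, Program.otherGates]
  ring

theorem calls_signalCore (k : ℕ → Bool → Matrix.unitaryGroup Bool ℂ) (n : ℕ) :
    Program.calls (signalCore a s k n) = n := by
  induction n with
  | zero => rfl
  | succ n ih => rw [signalCore, calls_append, ih, calls_signalStep]

theorem otherGates_signalCore (k : ℕ → Bool → Matrix.unitaryGroup Bool ℂ) (n : ℕ) :
    Program.otherGates (signalCore a s k n) = n * (12 * a + 3) + 1 := by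
  induction n with
  | zero => simp [signalCore, Program.otherGates]
  | succ n ih =>
    rw [signalCore, otherGates_append, ih, otherGates_signalStep]
    ring

theorem calls_evolutionCore (k : ℕ → Bool → Matrix.unitaryGroup Bool ℂ) (n : ℕ) :
    Program.calls (evolutionCore a s k n) = n + 1 := by
  simp only [evolutionCore, calls_append, calls_signalCore, calls_signalStep, Program.calls]
  ring

theorem otherGates_evolutionCore (k : ℕ → Bool → Matrix.unitaryGroup Bool ℂ) (n : ℕ) :
    Program.otherGates (evolutionCore a s k n) = (n + 1) * (12 * a + 3) + 3 := by
  simp only [evolutionCore, otherGates_append, otherGates_signalCore, otherGates_signalStep,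
    Program.otherGates]
  ring

theorem calls_scaledProgram (u : Matrix.unitaryGroup Bool ℂ) (P : Program (numAnc a) a s) :
    Program.calls (scaledProgram u P) = Program.calls P := by
  simp only [scaledProgram, calls_append, Program.calls]
  ring

theorem otherGates_scaledProgram (u : Matrix.unitaryGroup Bool ℂ) (P : Program (numAnc a) a s) :
    Program.otherGates (scaledProgram u P) = Program.otherGates P + 3 := by
  simp only [scaledProgram, otherGates_append, Program.otherGates]
  ring

theorem calls_amplify (P : Program (numAnc a) a s) :
    Program.calls (amplify P) = 3 * Program.calls P := by
  simp only [amplify, fullReflection, calls_append, calls_inv, calls_flagSign]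
  ring

theorem otherGates_amplify (P : Program (numAnc a) a s) :
    Program.otherGates (amplify P) = 3 * Program.otherGates P + (12 * a + 14) := by
  simp only [amplify, otherGates_append, otherGates_inv, otherGates_fullReflection]
  ring

theorem calls_idleCalls (m : ℕ) : Program.calls (idleCalls a s m) = m := by
  induction m with
  | zero => rfl
  | succ m ih => exact congrArg (· + 1) ih

theorem otherGates_idleCalls (m : ℕ) : Program.otherGates (idleCalls a s m) = 0 := by
  induction m with
  | zero => rfl
  | succ _ ih => exact ih

end Counting

section Circuits

variable {a s : ℕ}

/-- The block-encoding circuit of the evolution: the scaled linear combination of the even and the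
odd part of the exponential, with `n + 1` uses of the block-encoding of the Hamiltonian. -/
def encodingProgram (a s : ℕ) (u : Matrix.unitaryGroup Bool ℂ)
    (k : ℕ → Bool → Matrix.unitaryGroup Bool ℂ) (n : ℕ) : Program (numAnc a) a s :=
  scaledProgram u (evolutionCore a s k n)

/-- The simulation circuit: one round of amplification suffices, and `m` idle uses of the
block-encoding make up the prescribed number. -/
def simulationProgram (a s : ℕ) (k : ℕ → Bool → Matrix.unitaryGroup Bool ℂ) (n m : ℕ) :
    Program (numAnc a) a s :=
  idleCalls a s m ++ scaledProgram (signGate fun _ => true) (amplify (evolutionCore a s k n))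

theorem calls_encodingProgram (u : Matrix.unitaryGroup Bool ℂ)
    (k : ℕ → Bool → Matrix.unitaryGroup Bool ℂ) (n : ℕ) :
    Program.calls (encodingProgram a s u k n) = n + 1 := by
  rw [encodingProgram, calls_scaledProgram, calls_evolutionCore]

theorem otherGates_encodingProgram_le (u : Matrix.unitaryGroup Bool ℂ)
    (k : ℕ → Bool → Matrix.unitaryGroup Bool ℂ) (n : ℕ) :
    Program.otherGates (encodingProgram a s u k n) ≤
      16 * (a + 1) * Program.calls (encodingProgram a s u k n) := by
  rw [calls_encodingProgram, encodingProgram, otherGates_scaledProgram, otherGates_evolutionCore]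
  nlinarith [Nat.zero_le (n * a)]

theorem calls_simulationProgram (k : ℕ → Bool → Matrix.unitaryGroup Bool ℂ) (n m : ℕ) :
    Program.calls (simulationProgram a s k n m) = m + 3 * (n + 1) := by
  rw [simulationProgram, calls_append, calls_idleCalls, calls_scaledProgram, calls_amplify,
    calls_evolutionCore]

theorem otherGates_simulationProgram_le (k : ℕ → Bool → Matrix.unitaryGroup Bool ℂ) (n m : ℕ) :
    Program.otherGates (simulationProgram a s k n m) ≤
      16 * (a + 1) * Program.calls (simulationProgram a s k n m) := by
  rw [calls_simulationProgram, simulationProgram, otherGates_append, otherGates_idleCalls,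
    otherGates_scaledProgram, otherGates_amplify, otherGates_evolutionCore]
  nlinarith [Nat.zero_le (n * a), Nat.zero_le (m * a)]

variable {U : QOp (Fin a ⊕ Fin s)} {k : ℕ → Bool → Matrix.unitaryGroup Bool ℂ} {n : ℕ}

theorem zeroBlock_encodingProgram (hU : U ∈ Matrix.unitaryGroup (Fin a ⊕ Fin s → Bool) ℂ)
    (u : Matrix.unitaryGroup Bool ℂ) {B : QOp (Fin s)}
    (hB : (startEmb a s)ᴴ * (Program.toOp U (evolutionCore a s k n) * startEmb a s) = B) :
    zeroBlock (Program.toOp U (encodingProgram a s u k n)) = u.1 false false • B := by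
  rw [encodingProgram, zeroBlock_scaledProgram _ (preservesClean_evolutionCore hU k n), hB]

theorem zeroBlock_simulationProgram (hU : U ∈ Matrix.unitaryGroup (Fin a ⊕ Fin s → Bool) ℂ)
    {B : QOp (Fin s)}
    (hB : (startEmb a s)ᴴ * (Program.toOp U (evolutionCore a s k n) * startEmb a s) = B) (m : ℕ) :
    zeroBlock (Program.toOp U (simulationProgram a s k n m)) =
      (3 : ℂ) • B - (4 : ℂ) • (B * Bᴴ * B) := by
  have clean := preservesClean_evolutionCore hU k n
  have sign : (signGate fun _ => true).1 false false = (-1 : ℂ) := by simp [signGate]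
  rw [simulationProgram, zeroBlock_idleCalls_append, zeroBlock_scaledProgram _ (clean.amplify hU),
    block_amplify hU clean hB, sign, neg_one_smul, neg_sub]

end Circuits

section Simulation

variable {a s : ℕ}

/-- The circuit `V` block-encodes the evolution for the time `t`, for every Hamiltonian and every
block-encoding of it, with the prescribed number of uses. -/
structure EncodesEvolution (αH αHS ε t : ℝ) (V : Program (numAnc a) a s) : Prop where
  calls_eq : (V.calls : ℤ) = evolutionCalls αH ε t
  otherGates_le : V.otherGates ≤ 16 * (a + 1) * V.calls
  isBlockEncoding {H : QOp (Fin s)} {U : QOp (Fin a ⊕ Fin s)} (hH : H.IsHermitian)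
    (hBE : IsBlockEncoding αH 0 H U) : IsBlockEncoding αHS ε (evolution H t) (V.toOp U)

/-- The circuit `S` simulates the evolution for the time `t` of unit vectors, for every Hamiltonian
and every block-encoding of it. The norm `ν` of the initial state, before it is normalized, enters
only through the number of uses. -/
structure SimulatesEvolution (αH αHS ε ν t : ℝ) (S : Program (numAnc a) a s) : Prop where
  calls_eq : (S.calls : ℤ) = amplificationCalls αHS ν * evolutionCalls αH ε t
  otherGates_le : S.otherGates ≤ 16 * (a + 1) * S.calls
  close {H : QOp (Fin s)} {U : QOp (Fin a ⊕ Fin s)} (hH : H.IsHermitian)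
    (hBE : IsBlockEncoding αH 0 H U) {ψ : QVec (Fin s)} (hψ : ‖ψ‖ = 1) :
    1 - ε ≤ ‖postselect (S.toOp U) ψ‖ ^ 2 ∧
      ‖((‖postselect (S.toOp U) ψ‖⁻¹ : ℝ) : ℂ) • postselect (S.toOp U) ψ -
        Matrix.toEuclideanLin (evolution H t) ψ‖ ≤ ε

variable {αH αHS ε ν t : ℝ}

theorem exists_evolutionCalls_eq (hα : 0 ≤ αH) (hε : 0 < ε) (hε1 : ε < 1) (ht : 0 ≤ t) :
    ∃ n : ℕ, 1 ≤ n ∧ 2.8 * (αH * t) + Real.log (1 / ε) ≤ n ∧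
      ((2 * (n - 1) + 1 : ℕ) : ℤ) = evolutionCalls αH ε t := by
  have log_pos : 0 < Real.log (1 / ε) := Real.log_pos ((one_lt_div hε).2 hε1)
  have ceil_pos : 0 < ⌈2.8 * αH * t + Real.log (1 / ε)⌉ := Int.ceil_pos.2 (by positivity)
  obtain ⟨n, hn⟩ := Int.eq_ofNat_of_zero_le ceil_pos.le
  refine ⟨n, by omega, ?_, ?_⟩
  · have le_ceil := Int.le_ceil (2.8 * αH * t + Real.log (1 / ε))
    rw [hn] at le_ceil
    rw [← mul_assoc]
    exact_mod_cast le_ceil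
  · rw [evolutionCalls, hn]
    omega

theorem exists_amplificationCalls_eq (hα : αHS ≠ 0) (hν : 0 < ν) :
    ∃ m : ℕ, ((m + 3 : ℕ) : ℤ) = amplificationCalls αHS ν := by
  have ceil_pos : 0 < ⌈|αHS| / ν⌉ := Int.ceil_pos.2 (div_pos (abs_pos.2 hα) hν)
  refine ⟨(2 * ⌈|αHS| / ν⌉ - 2).toNat, ?_⟩
  rw [amplificationCalls]
  omega

theorem exists_encodesEvolution (hα : 0 ≤ αH) (hαHS : 2 ≤ αHS) (hε : 0 < ε) (hε1 : ε < 1)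
    (ht : 0 ≤ t) : ∃ V : Program (numAnc a) a s, EncodesEvolution αH αHS ε t V := by
  obtain ⟨n, hn, hle, hcalls⟩ := exists_evolutionCalls_eq hα hε hε1 ht
  obtain ⟨k, hk, hp⟩ := exists_phases (mul_nonneg hα ht) hε hε1.le hn hle
  have αHS_pos : 0 < αHS := by linarith
  have scale_le : |2 / αHS| ≤ 1 := by
    rwa [abs_of_pos (by positivity), div_le_one αHS_pos]
  refine ⟨encodingProgram a s (rotation (2 / αHS) scale_le) k (2 * (n - 1)),
    by rw [calls_encodingProgram, hcalls], otherGates_encodingProgram_le _ _ _,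
    fun {H U} hH hBE => ⟨αHS_pos.le, hε.le, toOp_mem_unitaryGroup hBE.unitary _, ?_⟩⟩
  have scale : (αHS : ℂ) * (rotation (2 / αHS) scale_le).1 false false * (1 / 2) = 1 := by
    have αHS_ne : (αHS : ℂ) ≠ 0 := Complex.ofReal_ne_zero.2 αHS_pos.ne'
    rw [show (rotation (2 / αHS) scale_le).1 false false = ((2 / αHS : ℝ) : ℂ) from rfl]
    push_cast
    field_simp
  have close := norm_smul_taylorEvolution_sub_le hH (by simpa using hBE.norm_le) ht hε hε1.le hn hle
  rw [zeroBlock_encodingProgram hBE.unitary _ (startEmb_block_evolutionCore hBE hH hk hp),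
    smul_smul, smul_smul, scale, one_smul, norm_sub_rev]
  linarith

theorem norm_amplified_sub_le_half {A E : QOp (Fin s)}
    (hE : E ∈ Matrix.unitaryGroup (Fin s → Bool) ℂ) (hε : 0 ≤ ε) (hε1 : ε ≤ 1)
    (hA : ‖(2 : ℂ) • A - E‖ ≤ 13 / 42 * ε) :
    ‖(3 : ℂ) • A - (4 : ℂ) • (A * Aᴴ * A) - E‖ ≤ ε / 2 := by
  refine (norm_amplified_sub_le hE hA).trans ?_
  have sq_le : ε ^ 2 ≤ ε := pow_le_of_le_one hε hε1 two_ne_zero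
  have cube_le : ε ^ 3 ≤ ε := pow_le_of_le_one hε hε1 three_ne_zero
  rw [mul_pow, mul_pow]
  linarith

theorem norm_postselect_sub_le {b : ℕ} {W : QOp (Wires b a s)} {E : QOp (Fin s)} {δ : ℝ}
    (h : ‖zeroBlock W - E‖ ≤ δ) {ψ : QVec (Fin s)} (hψ : ‖ψ‖ = 1) :
    ‖postselect W ψ - Matrix.toEuclideanLin E ψ‖ ≤ δ := by
  rw [postselect, ← LinearMap.sub_apply, ← map_sub]
  exact (Matrix.l2_opNorm_mulVec _ ψ).trans (by rwa [hψ, mul_one])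

theorem exists_simulatesEvolution (hα : 0 ≤ αH) (hαHS : αHS ≠ 0) (hε : 0 < ε) (hε1 : ε < 1)
    (hν : 0 < ν) (ht : 0 ≤ t) :
    ∃ S : Program (numAnc a) a s, SimulatesEvolution αH αHS ε ν t S := by
  obtain ⟨n, hn, hle, hcalls⟩ := exists_evolutionCalls_eq hα hε hε1 ht
  obtain ⟨m, hm⟩ := exists_amplificationCalls_eq hαHS hν
  obtain ⟨k, hk, hp⟩ := exists_phases (mul_nonneg hα ht) hε hε1.le hn hle
  refine ⟨simulationProgram a s k (2 * (n - 1)) (m * (2 * (n - 1) + 1)), ?_,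
    otherGates_simulationProgram_le _ _ _, fun {H U} hH hBE {ψ} hψ => ?_⟩
  · rw [calls_simulationProgram, ← hm, ← hcalls, ← add_mul, Nat.cast_mul]
  have hE := evolution_mem_unitaryGroup hH t
  have block_close : ‖(2 : ℂ) • ((1 / 2 : ℂ) • (((1 / (1 + ε / 6) : ℝ) : ℂ) •
      taylorEvolution H t n)) - evolution H t‖ ≤ 13 / 42 * ε := by
    rw [smul_smul, mul_one_div_cancel two_ne_zero, one_smul]
    exact norm_smul_taylorEvolution_sub_le hH (by simpa using hBE.norm_le) ht hε hε1.le hn hle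
  have close : ‖postselect (Program.toOp U (simulationProgram a s k (2 * (n - 1))
      (m * (2 * (n - 1) + 1)))) ψ - Matrix.toEuclideanLin (evolution H t) ψ‖ ≤ ε / 2 := by
    refine norm_postselect_sub_le ?_ hψ
    rw [zeroBlock_simulationProgram hBE.unitary (startEmb_block_evolutionCore hBE hH hk hp)]
    exact norm_amplified_sub_le_half hE hε.le hε1.le block_close
  have unit := (norm_toEuclideanLin_of_mem_unitaryGroup hE ψ).trans hψ
  have two_half : 2 * (ε / 2) = ε := mul_div_cancel₀ ε two_ne_zero
  have prob := one_sub_two_mul_le_norm_sq unit close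
  have dist := norm_inv_norm_smul_sub_le unit close
  rw [two_half] at prob dist
  exact ⟨prob, dist⟩

end Simulation

section TotalCost

variable {a s b : ℕ} {ι : Type*} [Fintype ι] {αH αHS ε ν : ℝ} {t : ι → ℝ} {S : ι → Program b a s}

theorem sum_mul_calls_eq
    (h : ∀ i, ((S i).calls : ℤ) = amplificationCalls αHS ν * evolutionCalls αH ε (t i)) (G : ℕ) :
    ∑ i, (G : ℤ) * ((S i).calls : ℤ) = ∑ i, costHSAA αH αHS ε ν G (t i) :=
  Finset.sum_congr rfl fun i _ => by rw [h, costHSAA, mul_comm]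

theorem sum_gateComplexity_le {C : ℕ}
    (h : ∀ i, ((S i).calls : ℤ) = amplificationCalls αHS ν * evolutionCalls αH ε (t i))
    (hC : ∀ i, (S i).otherGates ≤ C * (a + 1) * (S i).calls) (G : ℕ) :
    ∑ i, ((S i).gateComplexity G : ℤ) ≤ ∑ i, costHSAA αH αHS ε ν G (t i) +
      (C : ℤ) * ((a : ℤ) + 1) * ∑ i, costHSAA αH αHS ε ν 1 (t i) := by
  rw [← sum_mul_calls_eq h, ← sum_mul_calls_eq h, Finset.mul_sum, ← Finset.sum_add_distrib]
  refine Finset.sum_le_sum fun i _ => ?_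
  rw [Program.gateComplexity, Nat.cast_one, one_mul]
  exact_mod_cast Nat.add_le_add_left (hC i) _

end TotalCost

end OscSim

end

theorem corollary1_general :
    ∃ C : ℕ, ∀ (s a : ℕ) {ι : Type} [Fintype ι] (αH αHS ε ν : ℝ) (t : ι → ℝ),
      0 ≤ αH → 2 ≤ αHS → 0 < ε → ε < 1 → 0 < ν → (∀ i, 0 ≤ t i) →
      ∃ (b : ℕ) (V S : ι → OscSim.Program b a s),
        (∀ i,
          ((V i).calls : ℤ) = OscSim.evolutionCalls αH ε (t i) ∧
          ((S i).calls : ℤ) = OscSim.amplificationCalls αHS ν * ((V i).calls : ℤ) ∧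
          (V i).otherGates ≤ C * (a + 1) * (V i).calls ∧
          (S i).otherGates ≤ C * (a + 1) * (S i).calls) ∧
        ∀ (H : OscSim.QOp (Fin s)) (U : OscSim.QOp (Fin a ⊕ Fin s)) (G : ℕ),
          H.IsHermitian →
          OscSim.IsBlockEncoding αH 0 H U →
          (∀ i, OscSim.IsBlockEncoding αHS ε (OscSim.evolution H (t i)) ((V i).toOp U)) ∧
          (∀ ψ₀ : OscSim.QVec (Fin s), ‖ψ₀‖ = ν → ∀ i,
            let ψ : OscSim.QVec (Fin s) := ((‖ψ₀‖⁻¹ : ℝ) : ℂ) • ψ₀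
            let φ := OscSim.postselect ((S i).toOp U) ψ
            (S i).toOp U ∈ Matrix.unitaryGroup (OscSim.Wires b a s → Bool) ℂ ∧
            1 - ε ≤ ‖φ‖ ^ 2 ∧
            ‖((‖φ‖⁻¹ : ℝ) : ℂ) • φ -
              Matrix.toEuclideanLin (OscSim.evolution H (t i)) ψ‖ ≤ ε) ∧
          (∑ i, (G : ℤ) * ((S i).calls : ℤ)) = ∑ i, OscSim.costHSAA αH αHS ε ν G (t i) ∧
          (∑ i, ((S i).gateComplexity G : ℤ)) ≤ ∑ i, OscSim.costHSAA αH αHS ε ν G (t i) +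
            (C : ℤ) * ((a : ℤ) + 1) * ∑ i, OscSim.costHSAA αH αHS ε ν 1 (t i) := by
  refine ⟨16, fun s a ι _ αH αHS ε ν t hα hαHS hε hε1 hν ht => ?_⟩
  have αHS_ne : αHS ≠ 0 := by linarith
  choose V hV using fun i =>
    OscSim.exists_encodesEvolution (a := a) (s := s) hα hαHS hε hε1 (ht i)
  choose S hS using fun i =>
    OscSim.exists_simulatesEvolution (a := a) (s := s) hα αHS_ne hε hε1 hν (ht i)
  have calls (i) := (hS i).calls_eq
  refine ⟨_, V, S, fun i => ⟨(hV i).calls_eq, ?_, (hV i).otherGates_le, (hS i).otherGates_le⟩,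
    fun H U G hH hBE => ⟨fun i => (hV i).isBlockEncoding hH hBE, fun ψ₀ hψ₀ i => ?_, ?_, ?_⟩⟩
  · rw [(hV i).calls_eq, calls]
  · have unit : ‖((‖ψ₀‖⁻¹ : ℝ) : ℂ) • ψ₀‖ = 1 := by
      rw [norm_smul, Complex.norm_real, norm_inv, norm_norm, hψ₀, inv_mul_cancel₀ hν.ne']
    exact ⟨OscSim.toOp_mem_unitaryGroup hBE.unitary _, (hS i).close hH hBE unit⟩
  · exact OscSim.sum_mul_calls_eq calls G
  · exact OscSim.sum_gateComplexity_le calls (fun i => (hS i).otherGates_le) G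

theorem corollary1 :
    -- an absolute constant, for the gates outside of the block-encoding of the Hamiltonian
    ∃ C : ℕ, ∀ (s a M : ℕ) (αH αHS ε ν ti tf Δt : ℝ),
      0 ≤ αH → 2 ≤ αHS → 0 < ε → ε < 1 → 0 < ν → 0 ≤ ti → 0 < Δt → (M : ℝ) = (tf - ti) / Δt →
      -- circuits that depend on these numbers only, not on the Hamiltonian or the initial state:
      -- `V j` encodes the evolution up to the time `ti + j Δt`, `S j` is the amplified simulation
      ∃ (b : ℕ) (V S : Fin (M + 1) → OscSim.Program b a s),
        (∀ j : Fin (M + 1),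
          ((V j).calls : ℤ) = OscSim.evolutionCalls αH ε (ti + (j : ℕ) * Δt) ∧
          ((S j).calls : ℤ) = OscSim.amplificationCalls αHS ν * ((V j).calls : ℤ) ∧
          (V j).otherGates ≤ C * (a + 1) * (V j).calls ∧
          (S j).otherGates ≤ C * (a + 1) * (S j).calls) ∧
        ∀ (H : OscSim.QOp (Fin s)) (UH : List (OscSim.Gate (Fin a ⊕ Fin s))),
          H.IsHermitian →
          OscSim.IsBlockEncoding αH 0 H (OscSim.circuitOp UH) →
          -- `V j` is a block-encoding of the evolution operator with sub-normalization `αHS`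
          (∀ j : Fin (M + 1),
            OscSim.IsBlockEncoding αHS ε (OscSim.evolution H (ti + (j : ℕ) * Δt))
              ((V j).toOp (OscSim.circuitOp UH))) ∧
          -- `S j` is an `ε`-close simulation at the time `ti + j Δt`, with high probability
          (∀ ψ₀ : OscSim.QVec (Fin s), ‖ψ₀‖ = ν → ∀ j : Fin (M + 1),
            let ψ : OscSim.QVec (Fin s) := ((‖ψ₀‖⁻¹ : ℝ) : ℂ) • ψ₀
            let φ := OscSim.postselect ((S j).toOp (OscSim.circuitOp UH)) ψ
            (S j).toOp (OscSim.circuitOp UH) ∈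
              Matrix.unitaryGroup (OscSim.Wires b a s → Bool) ℂ ∧
            1 - ε ≤ ‖φ‖ ^ 2 ∧
            ‖((‖φ‖⁻¹ : ℝ) : ℂ) • φ -
              Matrix.toEuclideanLin (OscSim.evolution H (ti + (j : ℕ) * Δt)) ψ‖ ≤ ε) ∧
          -- the total cost, and the gates outside of the uses of the block-encoding
          (∑ j : Fin (M + 1), (UH.length : ℤ) * ((S j).calls : ℤ)) =
            OscSim.costSim αH αHS ε ν UH.length ti Δt M ∧
          (∑ j : Fin (M + 1), ((S j).gateComplexity UH.length : ℤ)) ≤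
            OscSim.costSim αH αHS ε ν UH.length ti Δt M +
              (C : ℤ) * ((a : ℤ) + 1) * OscSim.costSim αH αHS ε ν 1 ti Δt M := by
  obtain ⟨C, hC⟩ := corollary1_general
  refine ⟨C, fun s a M αH αHS ε ν ti _ Δt hα hαHS hε hε1 hν hti hΔt _ => ?_⟩
  obtain ⟨b, V, S, hcount, hsim⟩ := hC s a αH αHS ε ν (fun j : Fin (M + 1) => ti + (j : ℕ) * Δt)
    hα hαHS hε hε1 hν (fun j => by positivity)
  simp only [OscSim.costSim, Finset.sum_range]
  exact ⟨b, V, S, hcount, fun H UH => hsim H _ _⟩
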